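/- Let $k$ be a field of characteristic $0$, let $d \ge 0$, let $S = k[[x_0,\dots,x_d]]$ with maximal ideal $\mathfrak n = (x_0,\dots,x_d)$, and let $f \in \mathfrak n^2$ be a nonzero element. Put $R = S/(f)$ and let $R^\sharp = S[[u]]/(f+u^2)$, where $u$ is a new variable, be the double branched cover of $R$. A finitely generated module $M$ over a commutative noetherian Cohen-Macaulay local ring $(A,\mathfrak m)$ is called a lattice if it is maximal Cohen-Macaulay (that is, $M = 0$ or $\operatorname{depth} M = \dim A$) and $M_{\mathfrak p}$ is a free $A_{\mathfrak p}$-module for every prime ideal $\mathfrak p \neq \mathfrak m$; the ring $A$ is of finite lattice type if there are, up to isomorphism, only finitely many indecomposable lattices over $A$. Then $R$ is of finite lattice type if and only if $R^\sharp$ is of finite lattice type. -/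

import Mathlib

universe u

/-- The module `M` over the local ring `R` is maximal Cohen-Macaulay: it is finitely generated and
its depth is `dim R`, i.e. the maximal ideal contains an `M`-regular sequence of length `dim R`.
(If `M` is finitely generated and nonzero then, by Nakayama, a weakly `M`-regular sequence in the
maximal ideal is `M`-regular. As usual, the zero module counts as maximal Cohen-Macaulay over a
Cohen-Macaulay ring.) -/
structure IsMaximalCohenMacaulay (R : Type u) [CommRing R] [IsLocalRing R]
    (M : Type u) [AddCommGroup M] [Module R M] : Prop where
  finite : Module.Finite R M
  exists_regular : ∃ rs : List R, (∀ r ∈ rs, r ∈ IsLocalRing.maximalIdeal R) ∧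
    RingTheory.Sequence.IsWeaklyRegular M rs ∧ (rs.length : WithBot ℕ∞) = ringKrullDim R

/-- `M` is free on the punctured spectrum: `M_p` is a free `R_p`-module for each non-maximal
prime `p`. -/
def IsFreeOnPuncturedSpectrum (R : Type u) [CommRing R] [IsLocalRing R]
    (M : Type u) [AddCommGroup M] [Module R M] : Prop :=
  ∀ (p : Ideal R) [p.IsPrime], p ≠ IsLocalRing.maximalIdeal R →
    Module.Free (Localization.AtPrime p) (LocalizedModule.AtPrime p M)

/-- Lattices over `R`: maximal Cohen-Macaulay modules that are free on the punctured spectrum. -/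
structure IsLattice (R : Type u) [CommRing R] [IsLocalRing R]
    (M : Type u) [AddCommGroup M] [Module R M] : Prop where
  maximalCohenMacaulay : IsMaximalCohenMacaulay R M
  free_punctured : IsFreeOnPuncturedSpectrum R M

/-- `R` is of finite lattice type: up to isomorphism there are only finitely many indecomposable
lattices over `R`. -/
def IsOfFiniteLatticeType (R : Type u) [CommRing R] [IsLocalRing R] : Prop :=
  ∃ (n : ℕ) (L : Fin n → ModuleCat.{u} R), ∀ M : ModuleCat.{u} R,
    IsLattice R M → CategoryTheory.Indecomposable M → ∃ i, Nonempty (M ≅ L i)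

/-- The ideal `(x₀, …, x_d)` of `S = k[[x₀, …, x_d]]`. -/
noncomputable def variableIdeal (k : Type u) [Field k] (d : ℕ) : Ideal (MvPowerSeries (Fin (d + 1)) k) :=
  Ideal.span (Set.range MvPowerSeries.X)

/-- The hypersurface `R = S/(f)`, where `S = k[[x₀, …, x_d]]`. -/
abbrev Hypersurface {k : Type u} [Field k] {d : ℕ} (f : MvPowerSeries (Fin (d + 1)) k) : Type u :=
  MvPowerSeries (Fin (d + 1)) k ⧸ Ideal.span {f}

/-- The double branched cover `R♯ = S[[u]]/(f + u²)` of `R = S/(f)`. -/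
abbrev DoubleBranchedCover {k : Type u} [Field k] {d : ℕ}
    (f : MvPowerSeries (Fin (d + 1)) k) : Type u :=
  PowerSeries (MvPowerSeries (Fin (d + 1)) k) ⧸
    Ideal.span {PowerSeries.C f + PowerSeries.X ^ 2}

theorem constantCoeff_eq_zero_of_mem {k : Type u} [Field k] {d : ℕ}
    {f : MvPowerSeries (Fin (d + 1)) k} (hf : f ∈ variableIdeal k d ^ 2) :
    MvPowerSeries.constantCoeff f = 0 := by
  have h : variableIdeal k d ≤ RingHom.ker (MvPowerSeries.constantCoeff (σ := Fin (d + 1)) (R := k)) := by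
    rw [variableIdeal, Ideal.span_le]
    rintro _ ⟨i, rfl⟩
    simp [RingHom.mem_ker]
  exact h (Ideal.pow_le_self two_ne_zero hf)

theorem Hypersurface.isLocalRing {k : Type u} [Field k] {d : ℕ}
    {f : MvPowerSeries (Fin (d + 1)) k} (hf : f ∈ variableIdeal k d ^ 2) :
    IsLocalRing (Hypersurface f) := by
  have : Nontrivial (Hypersurface f) := by
    rw [Ideal.Quotient.nontrivial_iff, Ne, Ideal.span_singleton_eq_top,
      MvPowerSeries.isUnit_iff_constantCoeff, constantCoeff_eq_zero_of_mem hf]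
    exact not_isUnit_zero
  exact IsLocalRing.of_surjective' (Ideal.Quotient.mk _) Ideal.Quotient.mk_surjective

theorem DoubleBranchedCover.isLocalRing {k : Type u} [Field k] {d : ℕ}
    {f : MvPowerSeries (Fin (d + 1)) k} (hf : f ∈ variableIdeal k d ^ 2) :
    IsLocalRing (DoubleBranchedCover f) := by
  have : Nontrivial (DoubleBranchedCover f) := by
    rw [Ideal.Quotient.nontrivial_iff, Ne, Ideal.span_singleton_eq_top,
      PowerSeries.isUnit_iff_constantCoeff]
    simp [MvPowerSeries.isUnit_iff_constantCoeff, constantCoeff_eq_zero_of_mem hf]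
  have : IsLocalRing (PowerSeries (MvPowerSeries (Fin (d + 1)) k)) :=
    inferInstanceAs (IsLocalRing (MvPowerSeries Unit (MvPowerSeries (Fin (d + 1)) k)))
  exact IsLocalRing.of_surjective' (Ideal.Quotient.mk _) Ideal.Quotient.mk_surjective

/-! This is Knörrer's comparison of a hypersurface with its double branched cover. Write `A = S/(f)`
and `B = R♯`; then `B` is free over `S` on `1, u` with `u² = -f`, and `B/(u) = A`. Two constructions
link the lattices: `N ↦ N/uN` from `B` to `A`, and `M ↦` a syzygy of `M` over `B` from `A` to `B`.
Both preserve lattices (`DoubleCover.isLattice_baseChange`, `DoubleCover.isLattice_ker`). A module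
is a direct summand of what the round trip makes of it: `M` of `A ⊗ ker π`
(`DoubleCover.exists_retract_baseChange_ker`) and, since 2 is invertible, `N` of a syzygy of `N/uN`
(`DoubleCover.exists_retract_ker_quotPresentation`). So finitely many indecomposables on one side
leave room for only finitely many on the other.

Being a summand of a finite direct sum of members of a family is expressed by the identity lying in
`factorIdeal`. These ideals are compatible with base change and, up to maps through free modules,
with syzygies (`ker_map_mem_factorIdeal`); they also detect freeness on the punctured spectrum
(`isFreeOnPuncturedSpectrum_iff`). As `S` is complete, indecomposables have local endomorphism
rings, so an indecomposable with identity in `factorIdeal` is a retract of a single member. Finite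
lattice type thus amounts to one finite family serving all lattices
(`IsOfFiniteLatticeType.exists_family`, `IsOfFiniteLatticeType.of_family`).

Depth enters through regular sequences alone. The main consequence is that a maximal Cohen-Macaulay
`B`-module is free over the regular ring `S`, so that `u` is injective on it because `u² = -f` is.
-/

section DepthTheory

open IsLocalRing RingTheory.Sequence Pointwise

/-! ### Depth over noetherian local rings -/

section Depth

variable (R : Type*) [CommRing R] [IsLocalRing R]

/-- The maximal ideal contains a weakly `M`-regular sequence of length `n`. -/
def DepthAtLeast (n : ℕ) (M : Type*) [AddCommGroup M] [Module R M] : Prop :=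
  ∃ rs : List R, (∀ r ∈ rs, r ∈ maximalIdeal R) ∧ IsWeaklyRegular M rs ∧ rs.length = n

variable {R}

theorem depthAtLeast_zero (M : Type*) [AddCommGroup M] [Module R M] : DepthAtLeast R 0 M :=
  ⟨[], by simp, IsWeaklyRegular.nil R M, rfl⟩

theorem depthAtLeast_succ_iff {n : ℕ} {M : Type*} [AddCommGroup M] [Module R M] :
    DepthAtLeast R (n + 1) M ↔
      ∃ x ∈ maximalIdeal R, IsSMulRegular M x ∧ DepthAtLeast R n (QuotSMulTop x M) := by
  constructor
  · rintro ⟨rs, hm, hr, hl⟩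
    match rs, hl with
    | x :: rs, hl =>
      rw [isWeaklyRegular_cons_iff] at hr
      exact ⟨x, hm x (by simp), hr.1, rs, fun r h ↦ hm r (by simp [h]), hr.2, by simpa using hl⟩
  · rintro ⟨x, hx, hr, rs, hm, hrs, hl⟩
    refine ⟨x :: rs, ?_, (isWeaklyRegular_cons_iff M x rs).2 ⟨hr, hrs⟩, by simp [hl]⟩
    simpa using ⟨hx, hm⟩

theorem DepthAtLeast.of_linearEquiv {n : ℕ} {M N : Type*} [AddCommGroup M] [Module R M]
    [AddCommGroup N] [Module R N] (e : M ≃ₗ[R] N) (h : DepthAtLeast R n M) :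
    DepthAtLeast R n N := by
  obtain ⟨rs, hm, hr, hl⟩ := h
  exact ⟨rs, hm, (e.isWeaklyRegular_congr rs).1 hr, hl⟩

theorem isSMulRegular_quotSMulTop_iff {R M : Type*} [CommRing R] [AddCommGroup M] [Module R M]
    {x r : R} :
    IsSMulRegular (QuotSMulTop x M) r ↔ ∀ m w : M, r • m = x • w → ∃ m', m = x • m' := by
  rw [isSMulRegular_quotient_iff_mem_of_smul_mem]
  simp only [Submodule.mem_smul_pointwise_iff_exists, Submodule.mem_top, true_and]
  constructor
  · intro h m w hw
    obtain ⟨b, hb⟩ := h m ⟨w, hw.symm⟩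
    exact ⟨b, hb.symm⟩
  · rintro h m ⟨w, hw⟩
    obtain ⟨b, hb⟩ := h m w hw.symm
    exact ⟨b, hb.symm⟩

theorem isSMulRegular_of_quotSMulTop {R M : Type*} [CommRing R] [AddCommGroup M] [Module R M]
    {x r : R} (hx : IsSMulRegular M x)
    (h : IsSMulRegular (QuotSMulTop x M) r) : IsSMulRegular (QuotSMulTop r M) x := by
  rw [isSMulRegular_quotSMulTop_iff] at h ⊢
  intro m w hw
  obtain ⟨m', rfl⟩ := h w m hw.symm
  exact ⟨m', hx (by simpa [smul_comm r x] using hw)⟩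

theorem mk_quotSMulTop_eq_zero_iff {R M : Type*} [CommRing R] [AddCommGroup M] [Module R M]
    {x : R} {m : M} :
    (Submodule.Quotient.mk m : QuotSMulTop x M) = 0 ↔ ∃ m', m = x • m' := by
  rw [Submodule.Quotient.mk_eq_zero, Submodule.mem_smul_pointwise_iff_exists]
  simp [eq_comm]

/-- No nonzero element of `M` is killed by the maximal ideal. -/
def SocleFree (R : Type*) [CommRing R] [IsLocalRing R] (M : Type*) [AddCommGroup M]
    [Module R M] : Prop :=
  ∀ z : M, (∀ a ∈ maximalIdeal R, a • z = 0) → z = 0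

theorem socleFree_of_isSMulRegular {M : Type*} [AddCommGroup M] [Module R M] {x : R}
    (hx : x ∈ maximalIdeal R) (h : IsSMulRegular M x) : SocleFree R M :=
  fun _ hz ↦ h.right_eq_zero_of_smul (hz x hx)

theorem DepthAtLeast.socleFree {n : ℕ} {M : Type*} [AddCommGroup M] [Module R M]
    (h : DepthAtLeast R (n + 1) M) : SocleFree R M := by
  obtain ⟨x, hx, hr, -⟩ := depthAtLeast_succ_iff.1 h
  exact socleFree_of_isSMulRegular hx hr

theorem SocleFree.prod {M N : Type*} [AddCommGroup M] [Module R M] [AddCommGroup N] [Module R N]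
    (hM : SocleFree R M) (hN : SocleFree R N) : SocleFree R (M × N) := by
  rintro ⟨m, n⟩ h
  simp only [Prod.smul_mk, Prod.mk_eq_zero] at h ⊢
  exact ⟨hM m fun a ha ↦ (h a ha).1, hN n fun a ha ↦ (h a ha).2⟩

/-- Prime avoidance: a maximal ideal consisting of zero divisors lies in one associated prime, hence
kills a nonzero element. -/
theorem SocleFree.exists_isSMulRegular [IsNoetherianRing R] {M : Type*} [AddCommGroup M]
    [Module R M] [Module.Finite R M] (h : SocleFree R M) :
    ∃ x ∈ maximalIdeal R, IsSMulRegular M x := by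
  by_contra! hc
  have hsub : (maximalIdeal R : Set R) ⊆ ⋃ p ∈ associatedPrimes R M, (p : Set R) := by
    rw [biUnion_associatedPrimes_eq_compl_regular]
    exact fun x hx ↦ hc x hx
  obtain ⟨p, hp, hle⟩ := (Ideal.subset_union_prime_finite (associatedPrimes.finite R M)
    (f := id) 0 0 fun _ h _ _ ↦ h.isPrime).1 hsub
  obtain ⟨hprime, z, hz⟩ := isAssociatedPrime_iff.1 hp
  have hz0 : z = 0 := h z fun a ha ↦ by
    have := hle ha
    rw [id, hz] at this
    simpa [Submodule.mem_colon_singleton] using this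
  apply hprime.ne_top
  rw [hz, hz0]
  ext a
  simp [Submodule.mem_colon_singleton]

omit [IsLocalRing R] in
theorem isSMulRegular_prod_iff {M N : Type*} [AddCommGroup M] [Module R M] [AddCommGroup N]
    [Module R N] {x : R} :
    IsSMulRegular (M × N) x ↔ IsSMulRegular M x ∧ IsSMulRegular N x := by
  simp only [isSMulRegular_iff_right_eq_zero_of_smul, Prod.forall, Prod.smul_mk, Prod.mk_eq_zero]
  exact ⟨fun h ↦ ⟨fun m hm ↦ (h m 0 ⟨hm, smul_zero x⟩).1, fun n hn ↦ (h 0 n ⟨smul_zero x, hn⟩).2⟩,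
    fun h m n hmn ↦ ⟨h.1 m hmn.1, h.2 n hmn.2⟩⟩

/-- The quotients of `M` by `x` and `y` may be taken in either order. -/
noncomputable def quotSMulTopComm {R : Type*} [CommRing R] (x y : R) (M : Type*) [AddCommGroup M]
    [Module R M] : QuotSMulTop x (QuotSMulTop y M) ≃ₗ[R] QuotSMulTop y (QuotSMulTop x M) :=
  have key (x y : R) : x • (⊤ : Submodule R (QuotSMulTop y M)) ≤
      LinearMap.ker (QuotSMulTop.map y (Submodule.mkQ (x • (⊤ : Submodule R M)))) := by
    rintro _ h
    obtain ⟨z, -, rfl⟩ := Submodule.mem_smul_pointwise_iff_exists _ _ _ |>.1 h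
    obtain ⟨m, rfl⟩ := Submodule.Quotient.mk_surjective _ z
    rw [LinearMap.mem_ker, map_smul, QuotSMulTop.map_apply_mk, ← Submodule.Quotient.mk_smul,
      ← map_smul]
    have : (Submodule.mkQ (x • (⊤ : Submodule R M))) (x • m) = 0 :=
      mk_quotSMulTop_eq_zero_iff.2 ⟨m, rfl⟩
    rw [this, Submodule.Quotient.mk_zero]
  LinearEquiv.ofLinearMap
    (Submodule.liftQ _ (QuotSMulTop.map y (Submodule.mkQ _)) (key x y))
    (Submodule.liftQ _ (QuotSMulTop.map x (Submodule.mkQ _)) (key y x))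
    (by ext m; rfl) (by ext m; rfl)

/-- The depth of a quotient does not depend on the regular element. Socle-freeness passes from
`M/xM` to `M/yM`, so some `z` is regular on both; induction then compares `x` with `z` and `z` with
`y`. -/
theorem depthAtLeast_quotSMulTop_of_quotSMulTop [IsNoetherianRing R] {n : ℕ} :
    ∀ {M : Type*} [AddCommGroup M] [Module R M] [Module.Finite R M] {x y : R},
      x ∈ maximalIdeal R → y ∈ maximalIdeal R → IsSMulRegular M x → IsSMulRegular M y →
      DepthAtLeast R n (QuotSMulTop x M) → DepthAtLeast R n (QuotSMulTop y M) := by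
  induction n with
  | zero => intros; exact depthAtLeast_zero _
  | succ n ih =>
    intro M _ _ _ x y hx hy hxr hyr h
    have hsx : SocleFree R (QuotSMulTop x M) := h.socleFree
    have hsy : SocleFree R (QuotSMulTop y M) := by
      intro z hz
      obtain ⟨z, rfl⟩ := Submodule.Quotient.mk_surjective _ z
      have hz' (a : R) (ha : a ∈ maximalIdeal R) : ∃ t, a • z = y • t :=
        mk_quotSMulTop_eq_zero_iff.1 (by rw [Submodule.Quotient.mk_smul]; exact hz a ha)
      -- The relation `x z = y w` sends a socle element `z` of `M/yM` to a socle element `w` of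
      -- `M/xM`.
      obtain ⟨w, hw⟩ := hz' x hx
      have hw0 : (Submodule.Quotient.mk w : QuotSMulTop x M) = 0 := by
        refine hsx _ fun a ha ↦ ?_
        obtain ⟨t, ht⟩ := hz' a ha
        rw [← Submodule.Quotient.mk_smul, mk_quotSMulTop_eq_zero_iff]
        refine ⟨t, hyr ?_⟩
        simp only
        rw [smul_comm y a w, ← hw, smul_comm a x z, ht, smul_comm x y t]
      obtain ⟨w', rfl⟩ := mk_quotSMulTop_eq_zero_iff.1 hw0
      rw [mk_quotSMulTop_eq_zero_iff]
      refine ⟨w', hxr ?_⟩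
      simp only
      rw [hw, smul_comm]
    obtain ⟨z, hz, hreg⟩ := ((socleFree_of_isSMulRegular hx hxr).prod
      (hsx.prod hsy)).exists_isSMulRegular
    obtain ⟨-, hreg⟩ := isSMulRegular_prod_iff.1 hreg
    obtain ⟨hzx, hzy⟩ := isSMulRegular_prod_iff.1 hreg
    obtain ⟨w, hw, hwr, hwd⟩ := depthAtLeast_succ_iff.1 h
    have h1 : DepthAtLeast R n (QuotSMulTop z (QuotSMulTop x M)) := ih hw hz hwr hzx hwd
    have h2 : DepthAtLeast R n (QuotSMulTop y (QuotSMulTop z M)) :=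
      ih hx hy (isSMulRegular_of_quotSMulTop hxr hzx)
        (isSMulRegular_of_quotSMulTop hyr hzy) (h1.of_linearEquiv (quotSMulTopComm z x M))
    exact depthAtLeast_succ_iff.2 ⟨z, hz, hzy, h2.of_linearEquiv (quotSMulTopComm y z M)⟩

theorem DepthAtLeast.quotSMulTop [IsNoetherianRing R] {n : ℕ} {M : Type*} [AddCommGroup M]
    [Module R M] [Module.Finite R M] (h : DepthAtLeast R (n + 1) M) {x : R}
    (hx : x ∈ maximalIdeal R) (hxr : IsSMulRegular M x) : DepthAtLeast R n (QuotSMulTop x M) := by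
  obtain ⟨w, hw, hwr, hwd⟩ := depthAtLeast_succ_iff.1 h
  exact depthAtLeast_quotSMulTop_of_quotSMulTop hw hx hwr hxr hwd

/-- The depth lemma for the submodule in a short exact sequence. -/
theorem DepthAtLeast.of_exact [IsNoetherianRing R] {n : ℕ} :
    ∀ {X G M : Type*} [AddCommGroup X] [Module R X] [AddCommGroup G] [Module R G]
      [AddCommGroup M] [Module R M] [Module.Finite R X] [Module.Finite R G] [Module.Finite R M]
      {f : X →ₗ[R] G} {g : G →ₗ[R] M}, Function.Injective f → Function.Exact f g →
      Function.Surjective g → DepthAtLeast R (n + 1) G → DepthAtLeast R n M →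
      DepthAtLeast R (n + 1) X := by
  induction n with
  | zero =>
    intro X G M _ _ _ _ _ _ _ _ _ f g hf _ _ hG _
    obtain ⟨x, hx, hr, -⟩ := depthAtLeast_succ_iff.1 hG
    exact depthAtLeast_succ_iff.2 ⟨x, hx, hr.of_injective f hf, depthAtLeast_zero _⟩
  | succ n ih =>
    intro X G M _ _ _ _ _ _ _ _ _ f g hf hfg hg hG hM
    -- An element regular on both `G` and `M`; regularity on `M` keeps the sequence exact on the
    -- left modulo `z`.
    obtain ⟨z, hz, hreg⟩ := (hG.socleFree.prod hM.socleFree).exists_isSMulRegular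
    obtain ⟨hzG, hzM⟩ := isSMulRegular_prod_iff.1 hreg
    refine depthAtLeast_succ_iff.2 ⟨z, hz, hzG.of_injective f hf, ?_⟩
    refine ih (f := QuotSMulTop.map z f) (g := QuotSMulTop.map z g) ?_
      (QuotSMulTop.map_exact z hfg hg) (QuotSMulTop.map_surjective z hg)
      (hG.quotSMulTop hz hzG) (hM.quotSMulTop hz hzM)
    rw [injective_iff_map_eq_zero]
    intro x hx
    obtain ⟨x, rfl⟩ := Submodule.Quotient.mk_surjective _ x
    rw [QuotSMulTop.map_apply_mk, mk_quotSMulTop_eq_zero_iff] at hx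
    obtain ⟨m, hm⟩ := hx
    have hgm : g m = 0 := hzM.right_eq_zero_of_smul (by
      rw [← map_smul, ← hm, hfg.apply_apply_eq_zero])
    obtain ⟨x', rfl⟩ := (hfg m).1 hgm
    exact mk_quotSMulTop_eq_zero_iff.2 ⟨x', hf (by simpa using hm)⟩

theorem DepthAtLeast.of_retract {n : ℕ} :
    ∀ {M N : Type*} [AddCommGroup M] [Module R M] [AddCommGroup N] [Module R N]
      (i : N →ₗ[R] M) (p : M →ₗ[R] N), p ∘ₗ i = LinearMap.id → DepthAtLeast R n M →
      DepthAtLeast R n N := by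
  induction n with
  | zero => intros; exact depthAtLeast_zero _
  | succ n ih =>
    intro M N _ _ _ _ i p hip h
    obtain ⟨x, hx, hr, hd⟩ := depthAtLeast_succ_iff.1 h
    refine depthAtLeast_succ_iff.2 ⟨x, hx, hr.of_injective i ?_, ?_⟩
    · exact Function.LeftInverse.injective (g := p) fun y ↦ LinearMap.congr_fun hip y
    · refine ih (QuotSMulTop.map x i) (QuotSMulTop.map x p) ?_ hd
      rw [← QuotSMulTop.map_comp, hip, QuotSMulTop.map_id]

/-- Let `K` be the elements killed by `p`. If `K` lay in `xN`, regularity of `x` would give `K =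
xK`, so `K = 0` by Nakayama. Otherwise an element of `K` survives in `N/xN`, where `p` and `x` kill
it. -/
theorem exists_associatedPrime_quotSMulTop [IsNoetherianRing R] {N : Type*} [AddCommGroup N]
    [Module R N] [Module.Finite R N] {x : R} (hx : x ∈ maximalIdeal R) (hr : IsSMulRegular N x)
    {p : Ideal R} (hp : p ∈ associatedPrimes R N) :
    ∃ q ∈ associatedPrimes R (QuotSMulTop x N), p ≤ q ∧ x ∈ q := by
  obtain ⟨hprime, z₀, hz₀⟩ := isAssociatedPrime_iff.1 hp
  let K : Submodule R N :=
    { carrier := {z | ∀ a ∈ p, a • z = 0}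
      add_mem' := fun h h' a ha ↦ by rw [smul_add, h a ha, h' a ha, add_zero]
      zero_mem' := fun a _ ↦ smul_zero a
      smul_mem' := fun c z h a ha ↦ by rw [smul_comm, h a ha, smul_zero] }
  have hzK : z₀ ∈ K := fun a ha ↦ by
    rw [hz₀] at ha
    simpa [Submodule.mem_colon_singleton] using ha
  have hz0 : z₀ ≠ 0 := by
    rintro rfl
    apply hprime.ne_top
    rw [hz₀]
    ext a
    simp [Submodule.mem_colon_singleton]
  obtain ⟨z, hzK, hz⟩ : ∃ z ∈ K, (Submodule.Quotient.mk z : QuotSMulTop x N) ≠ 0 := by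
    by_contra! hc
    have hle : K ≤ maximalIdeal R • K := by
      intro z hz
      obtain ⟨w, rfl⟩ := mk_quotSMulTop_eq_zero_iff.1 (hc z hz)
      refine Submodule.smul_mem_smul hx fun a ha ↦ hr ?_
      simp only
      rw [smul_comm, hz a ha, smul_zero]
    have hbot : K = ⊥ := Submodule.eq_bot_of_le_smul_of_le_jacobson_bot _ K
      (IsNoetherian.noetherian K) hle (maximalIdeal_le_jacobson _)
    rw [hbot] at hzK
    exact hz0 hzK
  obtain ⟨q, hq, hle⟩ := exists_le_isAssociatedPrime_of_isNoetherianRing R _ hz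
  refine ⟨q, hq, fun a ha ↦ hle ?_, hle ?_⟩
  · rw [Submodule.mem_colon_singleton, ← Submodule.Quotient.mk_smul, hzK a ha]
    rfl
  · rw [Submodule.mem_colon_singleton, ← Submodule.Quotient.mk_smul]
    exact mk_quotSMulTop_eq_zero_iff.2 ⟨z, rfl⟩

/-- A regular element `x` lies outside `p` but in an associated prime of `N/xN` above `p`, so each
step of a regular sequence costs one dimension. -/
theorem DepthAtLeast.le_ringKrullDim_quotient [IsNoetherianRing R] {n : ℕ} :
    ∀ {N : Type*} [AddCommGroup N] [Module R N] [Module.Finite R N], DepthAtLeast R n N →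
      ∀ p ∈ associatedPrimes R N, (n : WithBot ℕ∞) ≤ ringKrullDim (R ⧸ p) := by
  induction n with
  | zero =>
    intro N _ _ _ _ p hp
    have := hp.isPrime
    exact ringKrullDim_nonneg_of_nontrivial
  | succ n ih =>
    intro N _ _ _ h p hp
    obtain ⟨x, hx, hr, hd⟩ := depthAtLeast_succ_iff.1 h
    obtain ⟨q, hq, hpq, hxq⟩ := exists_associatedPrime_quotSMulTop hx hr hp
    have hprime := hp.isPrime
    have hxp : x ∉ p := fun hxp ↦ by
      have : x ∈ ⋃ p ∈ associatedPrimes R N, (p : Set R) := Set.mem_biUnion hp hxp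
      rw [biUnion_associatedPrimes_eq_compl_regular] at this
      exact this hr
    have := ringKrullDim_succ_le_of_surjective (Ideal.Quotient.factor hpq)
      (Ideal.Quotient.factor_surjective hpq) (r := Ideal.Quotient.mk p x)
      (mem_nonZeroDivisors_of_ne_zero (by rwa [Ne, Ideal.Quotient.eq_zero_iff_mem]))
      (by simpa [Ideal.Quotient.eq_zero_iff_mem] using hxq)
    refine le_trans ?_ this
    push_cast
    gcongr
    exact ih hd q hq

theorem ringKrullDim_quotient_le_length [IsNoetherianRing R] {p : Ideal R} (hp : p ≠ ⊤)
    {rs : List R} (hrs : ∀ r ∈ rs, r ∈ maximalIdeal R)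
    (h : ∀ q : Ideal R, q.IsPrime → p ≤ q → (∀ r ∈ rs, r ∈ q) → q = maximalIdeal R) :
    ringKrullDim (R ⧸ p) ≤ rs.length := by
  classical
  have : Nontrivial (R ⧸ p) := Ideal.Quotient.nontrivial_iff.2 hp
  have : IsLocalRing (R ⧸ p) := .of_surjective' (Ideal.Quotient.mk p) Ideal.Quotient.mk_surjective
  let s : Finset (R ⧸ p) := (rs.map (Ideal.Quotient.mk p)).toFinset
  have hloc := IsLocalRing.of_surjective' (Ideal.Quotient.mk p) Ideal.Quotient.mk_surjective
  have hs : (s : Set (R ⧸ p)) ⊆ Ring.jacobson (R ⧸ p) := by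
    rw [IsLocalRing.ringJacobson_eq_maximalIdeal]
    intro y hy
    obtain ⟨r, hr, rfl⟩ : ∃ r ∈ rs, Ideal.Quotient.mk p r = y := by simpa [s] using hy
    have := hrs r hr
    rw [mem_maximalIdeal, mem_nonunits_iff] at this
    have hlocal : IsLocalHom (Ideal.Quotient.mk p) :=
      .of_surjective _ Ideal.Quotient.mk_surjective
    exact fun hu ↦ this (isUnit_of_map_unit _ r hu)
  refine (ringKrullDim_le_ringKrullDim_quotient_add_card s hs).trans ?_
  have h0 : ringKrullDim ((R ⧸ p) ⧸ Ideal.span (s : Set (R ⧸ p))) ≤ 0 := by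
    rw [← Nat.cast_zero, ← Ring.krullDimLE_iff]
    refine Ring.KrullDimLE.mk₀ fun I hI ↦ ?_
    let φ : R →+* (R ⧸ p) ⧸ Ideal.span (s : Set (R ⧸ p)) :=
      (Ideal.Quotient.mk _).comp (Ideal.Quotient.mk p)
    have hφ : Function.Surjective φ :=
      Ideal.Quotient.mk_surjective.comp Ideal.Quotient.mk_surjective
    have hmax := h (I.comap φ) inferInstance (fun a ha ↦ by
      simp [φ, Ideal.mem_comap, Ideal.Quotient.eq_zero_iff_mem.2 ha]) (fun r hr ↦ by
      have : φ r = 0 := by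
        rw [RingHom.comp_apply, Ideal.Quotient.eq_zero_iff_mem]
        refine Ideal.subset_span ?_
        simpa [s] using ⟨r, hr, rfl⟩
      simp [Ideal.mem_comap, this])
    have hImap : I = (I.comap φ).map φ := (Ideal.map_comap_of_surjective φ hφ I).symm
    have : (I.comap φ).IsMaximal := hmax ▸ maximalIdeal.isMaximal R
    rcases Ideal.map_eq_top_or_isMaximal_of_surjective φ hφ this with h | h
    · rw [← hImap] at h
      exact (hI.ne_top h).elim
    · rwa [← hImap] at h
  calc _ ≤ 0 + (s.card : WithBot ℕ∞) := by gcongr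
    _ ≤ rs.length := by
      rw [zero_add, Nat.cast_le]
      exact (List.toFinset_card_le _).trans (by simp)

/-- A sequence generating an `𝔪`-primary ideal modulo the annihilator of `N` is weakly `N`-regular
if its length is at most the depth of `N`. -/
theorem DepthAtLeast.isWeaklyRegular [IsNoetherianRing R] {rs : List R} :
    ∀ {N : Type*} [AddCommGroup N] [Module R N] [Module.Finite R N] (J : Ideal R),
      (∀ a ∈ J, ∀ z : N, a • z = 0) → (∀ r ∈ rs, r ∈ maximalIdeal R) →
      (∀ q : Ideal R, q.IsPrime → J ≤ q → (∀ r ∈ rs, r ∈ q) → q = maximalIdeal R) →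
      DepthAtLeast R rs.length N → IsWeaklyRegular N rs := by
  induction rs with
  | nil => intros; exact IsWeaklyRegular.nil R _
  | cons x rs ih =>
    intro N _ _ _ J hJ hm hq hd
    have hx := hm x (by simp)
    -- If `x` were in an associated prime `p`, the remaining elements alone would bound `dim R/p`,
    -- which is below the depth.
    have hreg : IsSMulRegular N x := by
      by_contra hc
      have : x ∈ ⋃ p ∈ associatedPrimes R N, (p : Set R) := by
        rw [biUnion_associatedPrimes_eq_compl_regular]
        exact hc
      obtain ⟨p, hp, hxp⟩ := Set.mem_iUnion₂.1 this
      have hprime := hp.isPrime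
      have h1 := hd.le_ringKrullDim_quotient p hp
      have hJp : J ≤ p := by
        obtain ⟨-, z, hz⟩ := isAssociatedPrime_iff.1 hp
        intro a ha
        rw [hz, Submodule.mem_colon_singleton, hJ a ha]
        rfl
      have h2 := ringKrullDim_quotient_le_length hprime.ne_top (rs := rs)
        (fun r hr ↦ hm r (by simp [hr]))
        (fun q hqp hpq hrs ↦ hq q hqp (hJp.trans hpq) (by simpa using ⟨hpq hxp, hrs⟩))
      have := h1.trans h2
      rw [List.length_cons, Nat.cast_le] at this
      omega
    refine (isWeaklyRegular_cons_iff N x rs).2 ⟨hreg, ?_⟩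
    refine ih (J ⊔ Ideal.span {x}) ?_ (fun r hr ↦ hm r (by simp [hr])) ?_ (hd.quotSMulTop hx hreg)
    · intro a ha z
      obtain ⟨b, hb, c, hc, rfl⟩ := Submodule.mem_sup.1 ha
      obtain ⟨c, rfl⟩ := Ideal.mem_span_singleton'.1 hc
      obtain ⟨z, rfl⟩ := Submodule.Quotient.mk_surjective _ z
      rw [← Submodule.Quotient.mk_smul, mk_quotSMulTop_eq_zero_iff]
      exact ⟨c • z, by rw [add_smul, hJ b hb, zero_add, mul_comm, mul_smul]⟩
    · intro q hqp hJq hrs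
      refine hq q hqp (le_sup_left.trans hJq) ?_
      simpa using ⟨hJq (Ideal.mem_sup_right (Ideal.mem_span_singleton_self x)), hrs⟩

theorem depthAtLeast_iff_of_surjective {A : Type*} [CommRing A] [IsLocalRing A] [Algebra R A]
    (hs : Function.Surjective (algebraMap R A)) {M : Type*} [AddCommGroup M] [Module R M]
    [Module A M] [IsScalarTower R A M] {n : ℕ} : DepthAtLeast R n M ↔ DepthAtLeast A n M := by
  have hlocal : IsLocalHom (algebraMap R A) := .of_surjective _ hs
  constructor
  · rintro ⟨rs, hm, hr, hl⟩
    refine ⟨rs.map (algebraMap R A), ?_, (isWeaklyRegular_map_algebraMap_iff A M rs).2 hr, by simpa⟩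
    intro a ha
    obtain ⟨r, hr, rfl⟩ := List.mem_map.1 ha
    exact map_mem_nonunits_iff _ _ |>.2 (hm r hr)
  · rintro ⟨rs, hm, hr, hl⟩
    obtain ⟨ss, rfl⟩ := List.map_surjective_iff.2 hs rs
    refine ⟨ss, fun r hr ↦ ?_, (isWeaklyRegular_map_algebraMap_iff A M ss).1 hr, by simpa using hl⟩
    exact map_mem_nonunits_iff (algebraMap R A) _ |>.1 (hm _ (List.mem_map_of_mem hr))

end Depth

/-- Over a local ring whose maximal ideal is generated by `rs`, a finite module on which `rs` is
weakly regular is free. -/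
theorem Module.free_of_isWeaklyRegular {R N : Type*} [CommRing R] [IsLocalRing R]
    [IsNoetherianRing R] [AddCommGroup N] [Module R N] [Module.Finite R N] {rs : List R}
    (hrs : Ideal.ofList rs = maximalIdeal R) (h : IsWeaklyRegular N rs) : Module.Free R N := by
  obtain ⟨n, g, hg⟩ := Module.Finite.exists_fin' R N
  refine Module.free_of_lTensor_residueField_injective (LinearMap.ker g).subtype g hg
    g.exact_subtype_ker_map ?_
  -- Regularity of `rs` on `N` keeps `ker g → Rⁿ` injective modulo the maximal ideal, i.e. `Tor₁` of
  -- `N` with the residue field vanishes.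
  have key := map_first_exact_on_four_term_right_exact_of_isSMulRegular_last
    (f₁ := (0 : PUnit →ₗ[R] LinearMap.ker g)) (f₂ := (LinearMap.ker g).subtype)
    (fun y ↦ by
      simp only [LinearMap.zero_apply, Set.mem_range, exists_const, Submodule.subtype_apply,
        ZeroMemClass.coe_eq_zero, eq_comm]) g.exact_subtype_ker_map hg h
  rw [hrs] at key
  have hinj : Function.Injective (Submodule.mapQ _ _ _ (Submodule.smul_top_le_comap_smul_top
      (maximalIdeal R) (LinearMap.ker g).subtype)) := by
    rw [injective_iff_map_eq_zero]
    intro y hy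
    obtain ⟨z, rfl⟩ := (key y).1 hy
    obtain ⟨z, rfl⟩ := Submodule.Quotient.mk_surjective _ z
    rw [Submodule.mapQ_apply, LinearMap.zero_apply, Submodule.Quotient.mk_zero]
  have hsq : TensorProduct.quotTensorEquivQuotSMul (Fin n → R) (maximalIdeal R) ∘ₗ
      (LinearMap.ker g).subtype.lTensor (R ⧸ maximalIdeal R) =
      Submodule.mapQ _ _ _ (Submodule.smul_top_le_comap_smul_top
        (maximalIdeal R) (LinearMap.ker g).subtype) ∘ₗ
      (TensorProduct.quotTensorEquivQuotSMul (LinearMap.ker g) (maximalIdeal R)).toLinearMap := by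
    refine TensorProduct.ext' fun a y ↦ ?_
    obtain ⟨a, rfl⟩ := Ideal.Quotient.mk_surjective a
    simp only [LinearMap.comp_apply, LinearMap.lTensor_tmul, LinearEquiv.coe_coe,
      TensorProduct.quotTensorEquivQuotSMul_mk_tmul, Submodule.mapQ_apply, map_smul]
  exact fun a b hab ↦ (hinj.comp (TensorProduct.quotTensorEquivQuotSMul (LinearMap.ker g)
    (maximalIdeal R)).injective) ((LinearMap.congr_fun hsq a).symm.trans
      ((congrArg (TensorProduct.quotTensorEquivQuotSMul (Fin n → R) (maximalIdeal R)) hab).trans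
        (LinearMap.congr_fun hsq b)))

end DepthTheory

/-! ### Idempotents in finite algebras over complete local rings -/

section LocalAlgebras

open IsLocalRing

section Idempotents

/-- The powers of `a` stabilise, `aⁿ = aⁿ⁺¹ b`, which makes `aⁿ bⁿ` idempotent and `aⁿ` a multiple
of it. -/
theorem IsArtinianRing.isNilpotent_or_isUnit_of_idempotents {C : Type*} [CommRing C]
    [IsArtinianRing C] (h : ∀ e : C, IsIdempotentElem e → e = 0 ∨ e = 1) (a : C) :
    IsNilpotent a ∨ IsUnit a := by
  obtain ⟨n, b, hb⟩ := IsArtinian.exists_pow_succ_smul_dvd a (1 : C)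
  simp only [smul_eq_mul, mul_one] at hb
  have key (m : ℕ) : a ^ n = a ^ (n + m) * b ^ m := by
    induction m with
    | zero => simp
    | succ m ih =>
      rw [ih, ← add_assoc]
      calc a ^ (n + m) * b ^ m = a ^ n * a ^ m * b ^ m := by ring
        _ = (a ^ n.succ * b) * a ^ m * b ^ m := by rw [hb]
        _ = _ := by rw [Nat.succ_eq_add_one]; ring
  have he : IsIdempotentElem (a ^ n * b ^ n) := by
    rw [IsIdempotentElem]
    nth_rw 3 [key n]
    ring
  have hk : a ^ n = a ^ n * (a ^ n * b ^ n) := by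
    nth_rw 1 [key n]
    ring
  rcases h _ he with h0 | h1
  · left
    exact ⟨n, by rw [hk, h0, mul_zero]⟩
  · rcases n.eq_zero_or_pos with rfl | hn
    · right
      exact .of_mul_eq_one b (by simpa using hb)
    · right
      exact (isUnit_pow_iff hn.ne').1 (.of_mul_eq_one _ h1)

theorem exists_isIdempotentElem_of_henselianRing {C : Type*} [CommRing C] (I : Ideal C)
    [HenselianRing C I] (e : C ⧸ I) (he : IsIdempotentElem e) :
    ∃ c : C, IsIdempotentElem c ∧ Ideal.Quotient.mk I c = e := by
  nontriviality C
  obtain ⟨a, rfl⟩ := Ideal.Quotient.mk_surjective e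
  have he' : Ideal.Quotient.mk I a * Ideal.Quotient.mk I a = Ideal.Quotient.mk I a := he
  obtain ⟨c, hc, hca⟩ := HenselianRing.is_henselian (I := I)
    (Polynomial.X ^ 2 - Polynomial.X : Polynomial C) (by monicity!) a (by
      simp [← Ideal.Quotient.eq_zero_iff_mem, pow_two, he']) (by
      -- The derivative `2a - 1` of `X² - X` is its own inverse modulo `I`: `(2e - 1)² = 1` for an
      -- idempotent `e`.
      refine IsUnit.of_mul_eq_one (2 * Ideal.Quotient.mk I a - 1) ?_
      simp
      linear_combination 4 * he')
  refine ⟨c, ?_, ?_⟩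
  · simp only [Polynomial.IsRoot, Polynomial.eval_sub, Polynomial.eval_pow, Polynomial.eval_X] at hc
    rw [IsIdempotentElem]
    linear_combination hc
  · exact Ideal.Quotient.eq.2 hca

theorem isPrecomplete_of_finite {S M : Type*} [CommRing S] (I : Ideal S) [IsPrecomplete I S]
    [AddCommGroup M] [Module S M] [Module.Finite S M] : IsPrecomplete I M := by
  rw [← AdicCompletion.of_surjective_iff]
  intro y
  obtain ⟨t, rfl⟩ := AdicCompletion.ofTensorProduct_surjective_of_finite I M y
  induction t with
  | zero => exact ⟨0, by simp⟩
  | add t t' h h' =>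
    obtain ⟨x, hx⟩ := h
    obtain ⟨x', hx'⟩ := h'
    exact ⟨x + x', by rw [map_add, map_add, hx, hx']⟩
  | tmul r x =>
    obtain ⟨s, rfl⟩ := AdicCompletion.of_surjective I S r
    refine ⟨s • x, ?_⟩
    rw [AdicCompletion.ofTensorProduct_tmul, map_smul]
    rfl

/-- Modulo the extended maximal ideal `C` is artinian; by completeness idempotents lift to `C` and
units are detected modulo that ideal. -/
theorem exists_isUnit_or_isUnit_one_sub_of_finite {S C : Type*} [CommRing S] [IsLocalRing S]
    [IsNoetherianRing S] [IsAdicComplete (maximalIdeal S) S] [CommRing C] [Algebra S C]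
    [Module.Finite S C] (h : ∀ e : C, IsIdempotentElem e → e = 0 ∨ e = 1) (a : C) :
    IsUnit a ∨ IsUnit (1 - a) := by
  let I := (maximalIdeal S).map (algebraMap S C)
  have : IsPrecomplete (maximalIdeal S) C := isPrecomplete_of_finite _
  have : IsAdicComplete (maximalIdeal S) C := {}
  have : IsAdicComplete I C := IsAdicComplete.map_algebraMap_iff _ _ |>.2 this
  have hunit (c : C) (hc : IsUnit (Ideal.Quotient.mk I c)) : IsUnit c := by
    obtain ⟨b, hb⟩ := hc.exists_right_inv
    obtain ⟨b, rfl⟩ := Ideal.Quotient.mk_surjective b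
    rw [← map_mul, ← map_one (Ideal.Quotient.mk I), Ideal.Quotient.eq] at hb
    have := (Ideal.mem_jacobson_bot.1 (IsAdicComplete.le_jacobson_bot I hb)) 1
    rw [mul_one, sub_add_cancel] at this
    exact isUnit_of_mul_isUnit_left this
  let : Module (S ⧸ maximalIdeal S) (C ⧸ I) := inferInstance
  let : Field (S ⧸ maximalIdeal S) := Ideal.Quotient.field _
  have : IsArtinianRing (C ⧸ I) := by
    have : IsScalarTower S (S ⧸ maximalIdeal S) (C ⧸ I) := inferInstance
    have : Module.Finite (S ⧸ maximalIdeal S) (C ⧸ I) := .of_restrictScalars_finite S _ _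
    have : IsArtinian (S ⧸ maximalIdeal S) (C ⧸ I) := inferInstance
    exact isArtinian_of_tower (S ⧸ maximalIdeal S) this
  rcases IsArtinianRing.isNilpotent_or_isUnit_of_idempotents (C := C ⧸ I) (fun e he ↦ by
    obtain ⟨c, hc, rfl⟩ := exists_isIdempotentElem_of_henselianRing I e he
    rcases h c hc with rfl | rfl <;> simp) (Ideal.Quotient.mk I a) with hn | hu
  · right
    apply hunit
    rw [map_sub, map_one]
    exact hn.isUnit_one_sub
  · left
    exact hunit a hu

/-- A finite algebra without nontrivial idempotents over a complete noetherian local ring is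
local. -/
theorem isUnit_or_isUnit_one_sub_of_finite {S E : Type*} [CommRing S] [IsLocalRing S]
    [IsNoetherianRing S] [IsAdicComplete (maximalIdeal S) S] [Ring E] [Algebra S E]
    [Module.Finite S E] (h : ∀ e : E, IsIdempotentElem e → e = 0 ∨ e = 1) (a : E) :
    IsUnit a ∨ IsUnit (1 - a) := by
  -- The commutative case is applied to `S[a]`, finite over `S` because `S` is noetherian.
  let C := Algebra.adjoin S {a}
  have : IsMulCommutative C := Algebra.isMulCommutative_adjoin S (by simp)
  have : Module.Finite S C := inferInstanceAs (Module.Finite S (Subalgebra.toSubmodule C))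
  have := exists_isUnit_or_isUnit_one_sub_of_finite (S := S) (C := C) (fun e he ↦ by
    rcases h e (congrArg Subtype.val he) with h | h
    · exact .inl (Subtype.ext h)
    · exact .inr (Subtype.ext h)) ⟨a, Algebra.self_mem_adjoin_singleton S a⟩
  exact this.imp (fun h ↦ h.map C.val) (fun h ↦ h.map C.val)

end Idempotents

end LocalAlgebras

/-! ### Maps factoring through a family, and Krull–Schmidt -/

section Decompositions

open IsLocalRing CategoryTheory

section FactorIdeal

/-- The sums of maps from `M` to `N` that factor through a member of the family `X`. -/
def factorIdeal (A : Type*) [CommRing A] {ι : Type*} (X : ι → Type*) [∀ i, AddCommGroup (X i)]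
    [∀ i, Module A (X i)] (M N : Type*) [AddCommGroup M] [Module A M] [AddCommGroup N]
    [Module A N] : Submodule A (M →ₗ[A] N) :=
  Submodule.span A {φ | ∃ (i : ι) (h : M →ₗ[A] X i) (g : X i →ₗ[A] N), φ = g ∘ₗ h}

variable {A : Type*} [CommRing A] {ι κ : Type*} {X : ι → Type*} [∀ i, AddCommGroup (X i)]
    [∀ i, Module A (X i)] {Y : κ → Type*} [∀ i, AddCommGroup (Y i)] [∀ i, Module A (Y i)]
    {M N M' N' : Type*} [AddCommGroup M] [Module A M] [AddCommGroup N] [Module A N]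
    [AddCommGroup M'] [Module A M'] [AddCommGroup N'] [Module A N']

theorem comp_mem_factorIdeal (i : ι) (h : M →ₗ[A] X i) (g : X i →ₗ[A] N) :
    g ∘ₗ h ∈ factorIdeal A X M N :=
  Submodule.subset_span ⟨i, h, g, rfl⟩

theorem factorIdeal_comp_comp {φ : M →ₗ[A] N} (hφ : φ ∈ factorIdeal A X M N) (h : M' →ₗ[A] M)
    (g : N →ₗ[A] N') : g ∘ₗ φ ∘ₗ h ∈ factorIdeal A X M' N' := by
  induction hφ using Submodule.span_induction with
  | mem φ hφ =>
    obtain ⟨i, h', g', rfl⟩ := hφ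
    exact comp_mem_factorIdeal i (h' ∘ₗ h) (g ∘ₗ g')
  | zero => simp
  | add φ ψ _ _ h1 h2 =>
    rw [LinearMap.add_comp, LinearMap.comp_add]
    exact add_mem h1 h2
  | smul a φ _ h1 =>
    rw [LinearMap.smul_comp, LinearMap.comp_smul]
    exact Submodule.smul_mem _ a h1

theorem factorIdeal_trans {φ : M →ₗ[A] N} (hφ : φ ∈ factorIdeal A X M N)
    (hX : ∀ i, (LinearMap.id : X i →ₗ[A] X i) ∈ factorIdeal A Y (X i) (X i)) :
    φ ∈ factorIdeal A Y M N := by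
  refine Submodule.span_le.2 ?_ hφ
  rintro _ ⟨i, h, g, rfl⟩
  exact factorIdeal_comp_comp (hX i) h g

theorem factorIdeal_mono (e : ι → κ) (f : ∀ i, X i ≃ₗ[A] Y (e i)) :
    factorIdeal A X M N ≤ factorIdeal A Y M N := by
  refine fun φ hφ ↦ factorIdeal_trans hφ fun i ↦ ?_
  have := comp_mem_factorIdeal (X := Y) (e i) (f i).toLinearMap (f i).symm.toLinearMap
  simpa using this

theorem id_mem_factorIdeal_of_retract (i : M →ₗ[A] N) (p : N →ₗ[A] M)
    (hpi : p ∘ₗ i = LinearMap.id) (h : LinearMap.id ∈ factorIdeal A X N N) :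
    LinearMap.id ∈ factorIdeal A X M M := by
  have := factorIdeal_comp_comp h i p
  rwa [LinearMap.id_comp, hpi] at this

theorem id_mem_factorIdeal_self (M : Type*) [AddCommGroup M] [Module A M] [Module.Finite A M]
    [Module.Projective A M] :
    (LinearMap.id : M →ₗ[A] M) ∈ factorIdeal A (fun _ : Unit ↦ A) M M := by
  obtain ⟨n, f, g, -, -, hfg⟩ := Module.Finite.exists_comp_eq_id_of_projective A M
  refine id_mem_factorIdeal_of_retract g f hfg ?_
  have : (LinearMap.id : (Fin n → A) →ₗ[A] (Fin n → A)) =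
      ∑ i, LinearMap.single A (fun _ ↦ A) i ∘ₗ LinearMap.proj i := by
    ext i j
    simp [Pi.single_apply]
  rw [this]
  exact sum_mem fun i _ ↦ comp_mem_factorIdeal (X := fun _ : Unit ↦ A) () _ _

end FactorIdeal

section KrullSchmidt

/-- `M` is nonzero and not a direct sum of two nonzero modules. -/
def IsIndecomposableModule (A M : Type*) [CommRing A] [AddCommGroup M] [Module A M] : Prop :=
  Nontrivial M ∧ ∀ e : Module.End A M, IsIdempotentElem e → e = 0 ∨ e = 1

theorem ModuleCat.indecomposable_iff {A : Type u} [CommRing A] (M : ModuleCat.{u} A) :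
    Indecomposable M ↔ IsIndecomposableModule A M := by
  constructor
  · rintro ⟨h0, h⟩
    refine ⟨?_, fun e he ↦ ?_⟩
    · rw [← not_subsingleton_iff_nontrivial]
      exact fun hs ↦ h0 (ModuleCat.isZero_of_subsingleton M)
    · have hc : IsCompl (LinearMap.range e) (LinearMap.ker e) :=
        LinearMap.IsIdempotentElem.isCompl he
      let φ := (Submodule.prodEquivOfIsCompl _ _ hc).symm
      have iso : M ≅ ModuleCat.of A (LinearMap.range e) ⊞ ModuleCat.of A (LinearMap.ker e) :=
        φ.toModuleIso ≪≫ (ModuleCat.biprodIsoProd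
          (ModuleCat.of A (LinearMap.range e)) (ModuleCat.of A (LinearMap.ker e))).symm
      rcases h _ _ iso with h | h
      · have := ModuleCat.subsingleton_of_isZero h
        left
        ext x
        exact congrArg Subtype.val (Subsingleton.elim (⟨e x, x, rfl⟩ : LinearMap.range e) 0)
      · have := ModuleCat.subsingleton_of_isZero h
        right
        ext x
        have hx : x - e x ∈ LinearMap.ker e := by
          rw [LinearMap.mem_ker, map_sub, sub_eq_zero]
          exact (LinearMap.congr_fun he x).symm
        have := congrArg Subtype.val (Subsingleton.elim (⟨x - e x, hx⟩ : LinearMap.ker e) 0)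
        exact (sub_eq_zero.1 this).symm
  · rintro ⟨hn, h⟩
    refine ⟨fun h0 ↦ ?_, fun Y Z iso ↦ ?_⟩
    · have := ModuleCat.subsingleton_of_isZero h0
      exact not_subsingleton M this
    · let φ : M ≃ₗ[A] Y × Z := (iso ≪≫ ModuleCat.biprodIsoProd Y Z).toLinearEquiv
      let e : Module.End A M := φ.symm.toLinearMap ∘ₗ LinearMap.inl A Y Z ∘ₗ
        LinearMap.fst A Y Z ∘ₗ φ.toLinearMap
      have he (x : M) : φ (e x) = ((φ x).1, 0) := by simp [e]
      have hidem : IsIdempotentElem e := by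
        refine LinearMap.ext fun x ↦ φ.injective ?_
        rw [Module.End.mul_apply, he, he]
      rcases h e hidem with h | h
      · left
        have : Subsingleton Y := by
          refine subsingleton_of_forall_eq 0 fun y ↦ ?_
          have := he (φ.symm (y, 0))
          simpa [h] using this.symm
        exact ModuleCat.isZero_of_subsingleton Y
      · right
        have : Subsingleton Z := by
          refine subsingleton_of_forall_eq 0 fun z ↦ ?_
          have := he (φ.symm (0, z))
          simpa [h] using this
        exact ModuleCat.isZero_of_subsingleton Z

/-- The endomorphism ring of `M` is local, so a unit written as a sum has a unit among its summands;
one factorization `g ∘ f` is therefore invertible. -/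
theorem IsIndecomposableModule.retract_of_id_mem_factorIdeal {S A : Type*} [CommRing S]
    [IsLocalRing S] [IsNoetherianRing S] [IsAdicComplete (maximalIdeal S) S] [CommRing A]
    [Algebra S A] [Module.Finite S A] {M : Type*} [AddCommGroup M] [Module A M] [Module.Finite A M]
    (hM : IsIndecomposableModule A M) {ι : Type*} {X : ι → Type*} [∀ i, AddCommGroup (X i)]
    [∀ i, Module A (X i)] (h : LinearMap.id ∈ factorIdeal A X M M) :
    ∃ i, ∃ (f : M →ₗ[A] X i) (g : X i →ₗ[A] M), g ∘ₗ f = LinearMap.id := by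
  let : Module S M := Module.compHom M (algebraMap S A)
  have : IsScalarTower S A M := .of_algebraMap_smul fun _ _ ↦ rfl
  have : Module.Finite S M := .trans A M
  have : IsNoetherianRing A := .of_finite S A
  have : Module.Finite A (Module.End A M) := inferInstance
  have : Module.Finite S (Module.End A M) := .trans A _
  have hloc (e : Module.End A M) := isUnit_or_isUnit_one_sub_of_finite (S := S) hM.2 e
  have key (φ : Module.End A M) (hφ : φ ∈ factorIdeal A X M M) (hu : IsUnit φ) :
      ∃ i, ∃ (f : M →ₗ[A] X i) (g : X i →ₗ[A] M), IsUnit (g ∘ₗ f : Module.End A M) := by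
    induction hφ using Submodule.span_induction with
    | mem φ hφ =>
      obtain ⟨i, f, g, rfl⟩ := hφ
      exact ⟨i, f, g, hu⟩
    | zero =>
      have := hM.1
      exact (not_isUnit_zero hu).elim
    | add φ ψ _ _ h1 h2 =>
      obtain ⟨v, hv⟩ := hu
      have hsum : (↑v⁻¹ : Module.End A M) * ψ = 1 - ↑v⁻¹ * φ := by
        rw [eq_sub_iff_add_eq, ← mul_add, add_comm ψ φ, ← hv, Units.inv_mul]
      rcases hloc (↑v⁻¹ * φ) with h | h
      · exact h1 ((Units.isUnit_units_mul _ _).1 h)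
      · rw [← hsum] at h
        exact h2 ((Units.isUnit_units_mul _ _).1 h)
    | smul a φ _ h1 =>
      refine h1 ?_
      have hc : a • φ = algebraMap A (Module.End A M) a * φ := by rw [Algebra.smul_def]
      rw [hc] at hu
      exact ((Algebra.commutes a φ : _ = _) |> fun hcomm ↦
        ((show Commute _ _ from hcomm).isUnit_mul_iff.1 hu).2)
  obtain ⟨i, f, g, hu⟩ := key LinearMap.id h isUnit_one
  obtain ⟨v, hv⟩ := hu
  refine ⟨i, f, (↑v⁻¹ : Module.End A M) ∘ₗ g, ?_⟩
  rw [LinearMap.comp_assoc, ← hv]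
  exact v.inv_mul

theorem IsLocalRing.finrank_residueField_tensor_pos {A M : Type*} [CommRing A] [IsLocalRing A]
    [AddCommGroup M] [Module A M] [Module.Finite A M] [Nontrivial M] :
    0 < Module.finrank (ResidueField A) (TensorProduct A (ResidueField A) M) := by
  have : Nontrivial (TensorProduct A (ResidueField A) M) := by
    by_contra hc
    rw [not_nontrivial_iff_subsingleton] at hc
    have : Subsingleton (TensorProduct A (A ⧸ maximalIdeal A) M) := hc
    have : Subsingleton (M ⧸ maximalIdeal A • (⊤ : Submodule A M)) :=
      (TensorProduct.quotTensorEquivQuotSMul M (maximalIdeal A)).symm.toEquiv.subsingleton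
    rw [Submodule.Quotient.subsingleton_iff] at this
    exact top_ne_bot (Submodule.eq_bot_of_le_smul_of_le_jacobson_bot (maximalIdeal A)
      (⊤ : Submodule A M) Module.Finite.fg_top this.ge (maximalIdeal_le_jacobson _))
  exact Module.finrank_pos

theorem exists_retract_trans {A Y N M : Type*} [CommRing A] [AddCommGroup Y] [Module A Y]
    [AddCommGroup N] [Module A N] [AddCommGroup M] [Module A M]
    (h : ∃ (f : Y →ₗ[A] N) (g : N →ₗ[A] Y), g ∘ₗ f = LinearMap.id) {i : N →ₗ[A] M}
    {p : M →ₗ[A] N} (hpi : p ∘ₗ i = LinearMap.id) :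
    ∃ (f : Y →ₗ[A] M) (g : M →ₗ[A] Y), g ∘ₗ f = LinearMap.id := by
  obtain ⟨f, g, hgf⟩ := h
  refine ⟨i ∘ₗ f, g ∘ₗ p, ?_⟩
  rw [LinearMap.comp_assoc, ← LinearMap.comp_assoc f, hpi, LinearMap.id_comp, hgf]

/-- Induction on the dimension of `M` tensored with the residue field: it is additive and, by
Nakayama, positive on nonzero modules, so it drops on both summands cut out by a nontrivial
idempotent. -/
theorem exists_indecomposable_decomposition_of_finrank {A : Type u} [CommRing A] [IsLocalRing A]
    [IsNoetherianRing A] (n : ℕ) : ∀ (M : Type u) [AddCommGroup M] [Module A M] [Module.Finite A M],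
    Module.finrank (ResidueField A) (TensorProduct A (ResidueField A) M) = n →
    ∃ (ι : Type) (_ : Finite ι) (Y : ι → ModuleCat.{u} A),
      (∀ i, IsIndecomposableModule A (Y i) ∧
        ∃ (f : Y i →ₗ[A] M) (g : M →ₗ[A] Y i), g ∘ₗ f = LinearMap.id) ∧
      LinearMap.id ∈ factorIdeal A (fun i ↦ Y i) M M := by
  induction n using Nat.strong_induction_on with
  | _ n ih =>
  intro M _ _ _ hn
  rcases subsingleton_or_nontrivial M with hs | hs
  · refine ⟨Empty, inferInstance, fun _ ↦ ModuleCat.of A M, by simp, ?_⟩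
    rw [Subsingleton.elim (LinearMap.id : M →ₗ[A] M) 0]
    exact zero_mem _
  by_cases hM : IsIndecomposableModule A M
  · exact ⟨Unit, inferInstance, fun _ ↦ ModuleCat.of A M,
      fun _ ↦ ⟨hM, LinearMap.id, LinearMap.id, rfl⟩,
      comp_mem_factorIdeal (X := fun _ : Unit ↦ M) () LinearMap.id LinearMap.id⟩
  simp only [IsIndecomposableModule, hs, true_and] at hM
  push Not at hM
  obtain ⟨e, he, he0, he1⟩ := hM
  have hc : IsCompl (LinearMap.range e) (LinearMap.ker e) :=
    LinearMap.IsIdempotentElem.isCompl he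
  have hr : Nontrivial (LinearMap.range e) := by
    rw [Submodule.nontrivial_iff_ne_bot, Ne, LinearMap.range_eq_bot]
    exact he0
  have hk : Nontrivial (LinearMap.ker e) := by
    rw [Submodule.nontrivial_iff_ne_bot]
    intro hk
    apply he1
    ext x
    exact LinearMap.ker_eq_bot.1 hk (LinearMap.congr_fun he x)
  have hsum := ((Submodule.prodEquivOfIsCompl _ _ hc).baseChange A (ResidueField A) _ _).finrank_eq
  rw [(TensorProduct.prodRight A (ResidueField A) (ResidueField A) _ _).finrank_eq,
    Module.finrank_prod, hn] at hsum
  have h1 := finrank_residueField_tensor_pos (A := A) (M := LinearMap.range e)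
  have h2 := finrank_residueField_tensor_pos (A := A) (M := LinearMap.ker e)
  obtain ⟨ι, _, Y, hY, hYid⟩ := ih _ (by omega) (LinearMap.range e) rfl
  obtain ⟨κ, _, Z, hZ, hZid⟩ := ih _ (by omega) (LinearMap.ker e) rfl
  let q : M →ₗ[A] LinearMap.ker e := (LinearMap.id - e).codRestrict _ fun x ↦ by
    simpa [sub_eq_zero] using (LinearMap.congr_fun he x).symm
  have he' (x : M) : e (e x) = e x := LinearMap.congr_fun he x
  have hr1 : e.rangeRestrict ∘ₗ (LinearMap.range e).subtype = LinearMap.id := by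
    ext ⟨_, x, rfl⟩
    exact he' x
  have hr2 : q ∘ₗ (LinearMap.ker e).subtype = LinearMap.id := by
    ext ⟨x, hx⟩
    simpa [q] using hx
  refine ⟨ι ⊕ κ, inferInstance, Sum.elim Y Z, ?_, ?_⟩
  · rintro (i | i)
    · exact ⟨(hY i).1, exists_retract_trans (hY i).2 hr1⟩
    · exact ⟨(hZ i).1, exists_retract_trans (hZ i).2 hr2⟩
  · have hid : (LinearMap.id : M →ₗ[A] M) =
        (LinearMap.range e).subtype ∘ₗ LinearMap.id ∘ₗ e.rangeRestrict +
        (LinearMap.ker e).subtype ∘ₗ LinearMap.id ∘ₗ q := by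
      ext x
      simp [q]
    rw [hid]
    refine add_mem ?_ ?_
    · exact factorIdeal_comp_comp (factorIdeal_mono 
        (Y := fun i ↦ ((Sum.elim Y Z i : ModuleCat.{u} A) : Type u)) Sum.inl
        (fun i ↦ LinearEquiv.refl A (Y i)) hYid) _ _
    · exact factorIdeal_comp_comp (factorIdeal_mono 
        (Y := fun i ↦ ((Sum.elim Y Z i : ModuleCat.{u} A) : Type u)) Sum.inr
        (fun i ↦ LinearEquiv.refl A (Z i)) hZid) _ _

/-- A finite module over a noetherian local ring is a finite direct sum of indecomposables. -/
theorem exists_indecomposable_decomposition {A : Type u} [CommRing A] [IsLocalRing A]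
    [IsNoetherianRing A] (M : Type u) [AddCommGroup M] [Module A M] [Module.Finite A M] :
    ∃ (ι : Type) (_ : Finite ι) (Y : ι → ModuleCat.{u} A),
      (∀ i, IsIndecomposableModule A (Y i) ∧
        ∃ (f : Y i →ₗ[A] M) (g : M →ₗ[A] Y i), g ∘ₗ f = LinearMap.id) ∧
      LinearMap.id ∈ factorIdeal A (fun i ↦ Y i) M M :=
  exists_indecomposable_decomposition_of_finrank _ M rfl

end KrullSchmidt

end Decompositions

/-! ### Base change, the punctured spectrum and finite lattice type -/

section Lattices

open IsLocalRing CategoryTheory TensorProduct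

section BaseChange

variable {A : Type*} [CommRing A] {ι : Type*} {X : ι → Type*} [∀ i, AddCommGroup (X i)]
    [∀ i, Module A (X i)] {M N : Type*} [AddCommGroup M] [Module A M] [AddCommGroup N] [Module A N]

theorem baseChange_mem_factorIdeal (B : Type*) [CommRing B] [Algebra A B] {φ : M →ₗ[A] N}
    (hφ : φ ∈ factorIdeal A X M N) :
    φ.baseChange B ∈ factorIdeal B (fun i ↦ B ⊗[A] X i) (B ⊗[A] M) (B ⊗[A] N) := by
  induction hφ using Submodule.span_induction with
  | mem φ hφ =>
    obtain ⟨i, h, g, rfl⟩ := hφ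
    rw [LinearMap.baseChange_comp]
    exact comp_mem_factorIdeal (X := fun i ↦ B ⊗[A] X i) i (h.baseChange B) (g.baseChange B)
  | zero => simp
  | add φ ψ _ _ h1 h2 =>
    rw [LinearMap.baseChange_add]
    exact add_mem h1 h2
  | smul a φ _ h1 =>
    rw [LinearMap.baseChange_smul, ← algebraMap_smul B a]
    exact Submodule.smul_mem _ _ h1

theorem baseChange_smul_id_mem_factorIdeal (B : Type*) [CommRing B] [Algebra A B] {a : A}
    (h : a • LinearMap.id ∈ factorIdeal A (fun _ : Unit ↦ A) M M) :
    algebraMap A B a • LinearMap.id ∈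
      factorIdeal B (fun _ : Unit ↦ B) (B ⊗[A] M) (B ⊗[A] M) := by
  have := baseChange_mem_factorIdeal B h
  rw [LinearMap.baseChange_smul, LinearMap.baseChange_id, ← algebraMap_smul B a] at this
  exact factorIdeal_mono id (fun _ ↦ AlgebraTensorModule.rid A B B) this

theorem restrictScalars_mem_factorIdeal (R : Type*) [CommRing R] [Algebra R A]
    [∀ i, Module R (X i)] [∀ i, IsScalarTower R A (X i)] [Module R M] [IsScalarTower R A M]
    [Module R N] [IsScalarTower R A N] (hs : Function.Surjective (algebraMap R A)) {φ : M →ₗ[A] N}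
    (hφ : φ ∈ factorIdeal A X M N) : φ.restrictScalars R ∈ factorIdeal R X M N := by
  induction hφ using Submodule.span_induction with
  | mem φ hφ =>
    obtain ⟨i, h, g, rfl⟩ := hφ
    exact comp_mem_factorIdeal i (h.restrictScalars R) (g.restrictScalars R)
  | zero => exact zero_mem _
  | add φ ψ _ _ h1 h2 => exact add_mem h1 h2
  | smul a φ _ h1 =>
    obtain ⟨r, rfl⟩ := hs a
    have : (algebraMap R A r • φ).restrictScalars R = r • φ.restrictScalars R := by
      ext x
      simp
    rw [this]
    exact Submodule.smul_mem _ r h1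

end BaseChange

section PuncturedSpectrum

theorem exists_projective_of_mem_factorIdeal {A : Type u} [CommRing A] {M N : Type*}
    [AddCommGroup M] [Module A M] [AddCommGroup N] [Module A N] {φ : M →ₗ[A] N}
    (hφ : φ ∈ factorIdeal A (fun _ : Unit ↦ A) M N) :
    ∃ (G : Type u) (_ : AddCommGroup G) (_ : Module A G) (_ : Module.Projective A G)
      (h : M →ₗ[A] G) (g : G →ₗ[A] N), φ = g ∘ₗ h := by
  induction hφ using Submodule.span_induction with
  | mem φ hφ =>
    obtain ⟨i, h, g, rfl⟩ := hφ
    exact ⟨A, inferInstance, inferInstance, inferInstance, h, g, rfl⟩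
  | zero => exact ⟨A, inferInstance, inferInstance, inferInstance, 0, 0, by simp⟩
  | add φ ψ _ _ h1 h2 =>
    obtain ⟨G, _, _, _, h, g, rfl⟩ := h1
    obtain ⟨G', _, _, _, h', g', rfl⟩ := h2
    exact ⟨G × G', inferInstance, inferInstance, inferInstance, h.prod h', g.coprod g', by
      ext x; simp⟩
  | smul a φ _ h1 =>
    obtain ⟨G, _, _, _, h, g, rfl⟩ := h1
    exact ⟨G, inferInstance, inferInstance, inferInstance, h, a • g, by ext; simp⟩

theorem projective_of_id_mem_factorIdeal {A : Type u} [CommRing A] {M : Type*}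
    [AddCommGroup M] [Module A M] (h : LinearMap.id ∈ factorIdeal A (fun _ : Unit ↦ A) M M) :
    Module.Projective A M := by
  obtain ⟨G, _, _, _, h, g, hgh⟩ := exists_projective_of_mem_factorIdeal h
  exact .of_split h g hgh.symm

/-- The `a` for which `a • id` factors through free modules form an ideal whose zero locus is the
non-free locus of `M`. The criterion turns a condition on localizations into one that base change
and syzygies preserve. -/
theorem isFreeOnPuncturedSpectrum_iff {A : Type u} [CommRing A] [IsLocalRing A]
    [IsNoetherianRing A] {M : Type u} [AddCommGroup M] [Module A M] [Module.Finite A M] :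
    IsFreeOnPuncturedSpectrum A M ↔ ∀ a ∈ maximalIdeal A, ∃ k : ℕ,
      a ^ k • LinearMap.id ∈ factorIdeal A (fun _ : Unit ↦ A) M M := by
  constructor
  · intro h a ha
    let I : Ideal A := (factorIdeal A (fun _ : Unit ↦ A) M M).comap
      (LinearMap.toSpanSingleton A (M →ₗ[A] M) LinearMap.id)
    change a ∈ I.radical
    rw [Ideal.radical_eq_sInf, Submodule.mem_sInf]
    rintro p ⟨hIp, hp⟩
    by_contra hap
    have hpm : p ≠ maximalIdeal A := fun hc ↦ hap (hc ▸ ha)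
    have := h p hpm
    obtain ⟨n, π, hπ⟩ := Module.Finite.exists_fin' A M
    let T := Ideal.primeCompl p
    let jG := LocalizedModule.mkLinearMap T (Fin n → A)
    let jM := LocalizedModule.mkLinearMap T M
    let πp := IsLocalizedModule.mapExtendScalars T jG jM (Localization.AtPrime p) π
    have hπp : Function.Surjective πp := IsLocalizedModule.map_surjective T jG jM π hπ
    -- A splitting of the localized presentation; clearing its denominators writes `c t • id` as `c
    -- • (π ∘ l)`, with `c t` outside `p`.
    obtain ⟨s, hs⟩ := Module.projective_lifting_property πp LinearMap.id hπp
    have := Module.finitePresentation_of_finite A M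
    obtain ⟨l, t, hl⟩ := Module.FinitePresentation.exists_lift_of_isLocalizedModule T jG
      (s.restrictScalars A ∘ₗ jM)
    have hcomp : jM ∘ₗ (π ∘ₗ l) = jM ∘ₗ (t • LinearMap.id) := by
      ext x
      have h1 : jG (l x) = t • s (jM x) := LinearMap.congr_fun hl x
      have h2 : πp (jG (l x)) = jM (π (l x)) := IsLocalizedModule.map_apply T jG jM π (l x)
      have h3 : πp (s (jM x)) = jM x := LinearMap.congr_fun hs (jM x)
      have h4 : πp (t • s (jM x)) = t • πp (s (jM x)) :=
        (πp.restrictScalars A).map_smul (t : A) (s (jM x))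
      have h5 : jM (t • x) = t • jM x := jM.map_smul (t : A) x
      simp only [LinearMap.comp_apply, LinearMap.smul_apply, LinearMap.id_apply]
      rw [← h2, h1, h4, h3, h5]
    obtain ⟨c, hc⟩ := Module.Finite.exists_smul_of_comp_eq_of_isLocalizedModule T jM _ _ hcomp
    have hmem : (c * t : A) ∈ I := by
      change (c * t : A) • LinearMap.id ∈ factorIdeal A (fun _ : Unit ↦ A) M M
      have : (c * t : A) • (LinearMap.id : M →ₗ[A] M) = (c : A) • (π ∘ₗ LinearMap.id ∘ₗ l) := by
        rw [mul_smul]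
        exact hc.symm
      rw [this]
      exact Submodule.smul_mem _ _ (factorIdeal_comp_comp (id_mem_factorIdeal_self _) l π)
    exact (c * t).2 (hIp hmem)
  · intro h p hp hpm
    obtain ⟨a, ham, hap⟩ : ∃ a ∈ maximalIdeal A, a ∉ p := by
      by_contra! hc
      exact hpm ((le_maximalIdeal hp.ne_top).antisymm hc)
    obtain ⟨k, hk⟩ := h a ham
    have h1 := baseChange_smul_id_mem_factorIdeal (Localization.AtPrime p) hk
    have hu : IsUnit (algebraMap A (Localization.AtPrime p) (a ^ k)) :=
      IsLocalization.map_units (M := p.primeCompl) _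
        ⟨a ^ k, fun hc ↦ hap (hp.mem_of_pow_mem k hc)⟩
    have h2 := Submodule.smul_mem _ (↑hu.unit⁻¹ : Localization.AtPrime p) h1
    rw [smul_smul, IsUnit.val_inv_mul, one_smul] at h2
    let e : Localization.AtPrime p ⊗[A] M ≃ₗ[Localization.AtPrime p] LocalizedModule.AtPrime p M :=
      (IsLocalizedModule.isBaseChange p.primeCompl (Localization.AtPrime p)
        (LocalizedModule.mkLinearMap p.primeCompl M)).equiv
    have := projective_of_id_mem_factorIdeal h2
    have : Module.Projective (Localization.AtPrime p) (LocalizedModule.AtPrime p M) := .of_equiv e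
    have : Module.Finite (Localization.AtPrime p) (LocalizedModule.AtPrime p M) := .equiv e
    exact Module.free_of_flat_of_isLocalRing

end PuncturedSpectrum

section FiniteType

variable {A : Type u} [CommRing A] [IsLocalRing A]

theorem isMaximalCohenMacaulay_iff {n : ℕ} (hn : ringKrullDim A = n) {M : Type u} [AddCommGroup M]
    [Module A M] : IsMaximalCohenMacaulay A M ↔ Module.Finite A M ∧ DepthAtLeast A n M := by
  constructor
  · rintro ⟨h, rs, hm, hr, hl⟩
    exact ⟨h, rs, hm, hr, by rw [hn] at hl; exact_mod_cast hl⟩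
  · rintro ⟨h, rs, hm, hr, hl⟩
    exact ⟨h, rs, hm, hr, by rw [hn, hl]⟩

theorem IsMaximalCohenMacaulay.of_retract {M N : Type u} [AddCommGroup M] [Module A M]
    [AddCommGroup N] [Module A N] (f : N →ₗ[A] M) (g : M →ₗ[A] N) (hgf : g ∘ₗ f = LinearMap.id)
    (h : IsMaximalCohenMacaulay A M) : IsMaximalCohenMacaulay A N := by
  obtain ⟨hM, rs, hm, hr, hl⟩ := h
  obtain ⟨ss, hsm, hsr, hsl⟩ := DepthAtLeast.of_retract f g hgf ⟨rs, hm, hr, rfl⟩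
  exact ⟨.of_surjective g fun y ↦ ⟨f y, LinearMap.congr_fun hgf y⟩, ss, hsm, hsr, hsl ▸ hl⟩

theorem IsFreeOnPuncturedSpectrum.of_retract [IsNoetherianRing A] {M N : Type u} [AddCommGroup M]
    [Module A M] [Module.Finite A M] [AddCommGroup N] [Module A N] (f : N →ₗ[A] M) (g : M →ₗ[A] N)
    (hgf : g ∘ₗ f = LinearMap.id) (h : IsFreeOnPuncturedSpectrum A M) :
    IsFreeOnPuncturedSpectrum A N := by
  have : Module.Finite A N := .of_surjective g fun y ↦ ⟨f y, LinearMap.congr_fun hgf y⟩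
  rw [isFreeOnPuncturedSpectrum_iff] at h ⊢
  intro a ha
  obtain ⟨k, hk⟩ := h a ha
  refine ⟨k, ?_⟩
  have := factorIdeal_comp_comp hk f g
  rwa [LinearMap.smul_comp, LinearMap.id_comp, LinearMap.comp_smul, hgf] at this

theorem IsLattice.of_retract [IsNoetherianRing A] {M N : Type u} [AddCommGroup M] [Module A M]
    [AddCommGroup N] [Module A N] (f : N →ₗ[A] M) (g : M →ₗ[A] N) (hgf : g ∘ₗ f = LinearMap.id)
    (h : IsLattice A M) : IsLattice A N :=
  have := h.maximalCohenMacaulay.finite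
  ⟨h.maximalCohenMacaulay.of_retract f g hgf, h.free_punctured.of_retract f g hgf⟩

omit [IsLocalRing A] in
theorem IsIndecomposableModule.linearEquiv_of_retract {M N : Type*} [AddCommGroup M] [Module A M]
    [AddCommGroup N] [Module A N] (hM : IsIndecomposableModule A M) [Nontrivial N]
    {f : N →ₗ[A] M} {g : M →ₗ[A] N} (hgf : g ∘ₗ f = LinearMap.id) : Nonempty (N ≃ₗ[A] M) := by
  have hg (y : N) : g (f y) = y := LinearMap.congr_fun hgf y
  have hidem : IsIdempotentElem (f ∘ₗ g : Module.End A M) := by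
    ext x
    simp [hg]
  rcases hM.2 _ hidem with h | h
  · obtain ⟨y, hy⟩ := exists_ne (0 : N)
    have : f (g (f y)) = 0 := LinearMap.congr_fun h (f y)
    rw [hg] at this
    exact (hy (by rw [← hg y, this, map_zero])).elim
  · exact ⟨.ofLinearMap f g h hgf⟩

theorem IsOfFiniteLatticeType.exists_family [IsNoetherianRing A] (h : IsOfFiniteLatticeType A) :
    ∃ (ι : Type) (_ : Finite ι) (L : ι → ModuleCat.{u} A), (∀ i, IsLattice A (L i)) ∧
      ∀ (M : Type u) [AddCommGroup M] [Module A M], IsLattice A M →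
        LinearMap.id ∈ factorIdeal A (fun i ↦ L i) M M := by
  obtain ⟨n, L, hL⟩ := h
  refine ⟨{i // IsLattice A (L i)}, inferInstance, fun i ↦ L i, fun i ↦ i.2, fun M _ _ hM ↦ ?_⟩
  have := hM.maximalCohenMacaulay.finite
  obtain ⟨κ, _, Y, hY, hid⟩ := exists_indecomposable_decomposition (A := A) M
  have key (j : κ) : ∃ i : {i // IsLattice A (L i)}, Nonempty (Y j ≃ₗ[A] L i) := by
    obtain ⟨hYj, f, g, hfg⟩ := hY j
    have hlat : IsLattice A (Y j) := hM.of_retract f g hfg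
    obtain ⟨i, ⟨e⟩⟩ := hL (Y j) hlat ((ModuleCat.indecomposable_iff _).2 hYj)
    let e := e.toLinearEquiv
    exact ⟨⟨i, hlat.of_retract e.symm.toLinearMap e.toLinearMap (by simp)⟩, ⟨e⟩⟩
  choose e he using key
  exact factorIdeal_mono (Y := fun i : {i // IsLattice A (L i)} ↦ L i) e (fun j ↦ (he j).some) hid

/-- The members of the family need only be finite modules: each indecomposable lattice is a retract
of, hence isomorphic to, one of their finitely many indecomposable summands. -/
theorem IsOfFiniteLatticeType.of_family {S : Type*} [CommRing S] [IsLocalRing S]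
    [IsNoetherianRing S] [IsAdicComplete (maximalIdeal S) S] [Algebra S A] [Module.Finite S A]
    {ι : Type*} [Finite ι] (X : ι → ModuleCat.{u} A) [∀ i, Module.Finite A (X i)]
    (h : ∀ (M : Type u) [AddCommGroup M] [Module A M], IsLattice A M →
      LinearMap.id ∈ factorIdeal A (fun i ↦ X i) M M) : IsOfFiniteLatticeType A := by
  have : IsNoetherianRing A := .of_finite S A
  choose κ hκ Y hY hid using fun i ↦ exists_indecomposable_decomposition (A := A) (X i)
  have hfin : Finite (Σ i, κ i) := inferInstance
  obtain ⟨n, ⟨e⟩⟩ := Finite.exists_equiv_fin (Σ i, κ i)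
  refine ⟨n, fun j ↦ Y (e.symm j).1 (e.symm j).2, fun M hM hMi ↦ ?_⟩
  have := hM.maximalCohenMacaulay.finite
  rw [ModuleCat.indecomposable_iff] at hMi
  have hMid : LinearMap.id ∈ factorIdeal A (fun j : Σ i, κ i ↦ Y j.1 j.2) M M := by
    refine factorIdeal_trans (h M hM) fun i ↦ ?_
    exact factorIdeal_mono (Y := fun j : Σ i, κ i ↦ Y j.1 j.2) (fun j ↦ ⟨i, j⟩)
      (fun j ↦ LinearEquiv.refl A (Y i j)) (hid i)
  obtain ⟨j, f, g, hgf⟩ := hMi.retract_of_id_mem_factorIdeal (S := S) hMid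
  have := hMi.1
  obtain ⟨φ⟩ := (hY j.1 j.2).1.linearEquiv_of_retract hgf
  refine ⟨e j, ?_⟩
  change Nonempty (M ≅ Y (e.symm (e j)).1 (e.symm (e j)).2)
  rw [Equiv.symm_apply_apply]
  exact ⟨φ.toModuleIso⟩

end FiniteType

end Lattices

/-! ### Syzygies and the two round trips -/

section DoubleCovers

open TensorProduct

section Syzygy

variable {B : Type*} [CommRing B] {ι : Type*} {L G : ι → Type*} [∀ i, AddCommGroup (L i)]
    [∀ i, Module B (L i)] [∀ i, AddCommGroup (G i)] [∀ i, Module B (G i)]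
    [∀ i, Module.Projective B (G i)] {q : ∀ i, G i →ₗ[B] L i}
    {M M' P P' : Type*} [AddCommGroup M] [Module B M] [AddCommGroup M'] [Module B M']
    [AddCommGroup P] [Module B P] [AddCommGroup P'] [Module B P'] [Module.Projective B P]
    [Module.Finite B P] {π : P →ₗ[B] M} {π' : P' →ₗ[B] M'}

omit [∀ i, Module.Projective B (G i)] in
-- A lift of the zero map sends all of `P` into `ker π'`, so `ρ` factors through the projective `P`.
-- Hence two lifts of one map agree up to free modules.
theorem ker_map_mem_factorIdeal_of_comp_eq_zero {Φ : P →ₗ[B] P'}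
    {ρ : LinearMap.ker π →ₗ[B] LinearMap.ker π'} (hΦ : π' ∘ₗ Φ = 0) (hρ : ∀ x, (ρ x : P') = Φ x) :
    ρ ∈ factorIdeal B (fun _ : Unit ↦ B) (LinearMap.ker π) (LinearMap.ker π') := by
  have : ρ = Φ.codRestrict (LinearMap.ker π') (LinearMap.congr_fun hΦ) ∘ₗ LinearMap.id ∘ₗ
      (LinearMap.ker π).subtype := by
    ext x
    exact hρ x
  rw [this]
  exact factorIdeal_comp_comp (id_mem_factorIdeal_self P) _ _

/-- If `φ` factors through the family `L`, then each map that it induces on syzygies factors through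
the syzygies of the members of `L`, up to a map factoring through a free module. -/
theorem ker_map_mem_factorIdeal (hq : ∀ i, Function.Surjective (q i))
    (hπ' : Function.Surjective π') {φ : M →ₗ[B] M'} (hφ : φ ∈ factorIdeal B L M M') :
    ∀ {Φ : P →ₗ[B] P'} {ρ : LinearMap.ker π →ₗ[B] LinearMap.ker π'}, π' ∘ₗ Φ = φ ∘ₗ π →
      (∀ x, (ρ x : P') = Φ x) →
      ρ ∈ factorIdeal B (fun i ↦ LinearMap.ker (q i)) (LinearMap.ker π) (LinearMap.ker π') ⊔
        factorIdeal B (fun _ : Unit ↦ B) (LinearMap.ker π) (LinearMap.ker π') := by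
  -- For sums and multiples the given `Φ` is compared with a chosen lift of one constituent; the
  -- difference lifts the other constituent, or zero.
  have lift (ψ : M →ₗ[B] M') : ∃ (Ψ : P →ₗ[B] P')
      (σ : LinearMap.ker π →ₗ[B] LinearMap.ker π'), π' ∘ₗ Ψ = ψ ∘ₗ π ∧
      ∀ x, (σ x : P') = Ψ x := by
    obtain ⟨Ψ, hΨ⟩ := Module.projective_lifting_property π' (ψ ∘ₗ π) hπ'
    refine ⟨Ψ, Ψ.restrict fun x hx ↦ ?_, hΨ, fun x ↦ rfl⟩
    have := LinearMap.congr_fun hΨ x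
    simpa [LinearMap.mem_ker.1 hx] using this
  induction hφ using Submodule.span_induction with
  | mem φ hφ =>
    intro Φ ρ hΦ hρ
    obtain ⟨i, h, g, rfl⟩ := hφ
    obtain ⟨H, hH⟩ := Module.projective_lifting_property (q i) (h ∘ₗ π) (hq i)
    obtain ⟨K, hK⟩ := Module.projective_lifting_property π' (g ∘ₗ q i) hπ'
    let H' : LinearMap.ker π →ₗ[B] LinearMap.ker (q i) := H.restrict fun x hx ↦ by
      have := LinearMap.congr_fun hH x
      simpa [LinearMap.mem_ker.1 hx] using this
    let K' : LinearMap.ker (q i) →ₗ[B] LinearMap.ker π' := K.restrict fun x hx ↦ by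
      have := LinearMap.congr_fun hK x
      simpa [LinearMap.mem_ker.1 hx] using this
    have hsub : ρ - K' ∘ₗ H' ∈
        factorIdeal B (fun _ : Unit ↦ B) (LinearMap.ker π) (LinearMap.ker π') := by
      refine ker_map_mem_factorIdeal_of_comp_eq_zero (Φ := Φ - K ∘ₗ H) ?_ fun x ↦ ?_
      · rw [LinearMap.comp_sub, hΦ, ← LinearMap.comp_assoc, hK, LinearMap.comp_assoc,
          LinearMap.comp_assoc, hH, sub_self]
      · simp [hρ, H', K']
    rw [← add_sub_cancel (K' ∘ₗ H') ρ]
    exact add_mem (Submodule.mem_sup_left (comp_mem_factorIdeal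
      (X := fun i ↦ LinearMap.ker (q i)) i H' K')) (Submodule.mem_sup_right hsub)
  | zero =>
    intro Φ ρ hΦ hρ
    exact Submodule.mem_sup_right (ker_map_mem_factorIdeal_of_comp_eq_zero
      (hΦ.trans (LinearMap.zero_comp π)) hρ)
  | add φ ψ _ _ h1 h2 =>
    intro Φ ρ hΦ hρ
    obtain ⟨Ψ, σ, hΨ, hσ⟩ := lift φ
    rw [← add_sub_cancel σ ρ]
    refine add_mem (h1 hΨ hσ) (h2 (Φ := Φ - Ψ) ?_ fun x ↦ ?_)
    · rw [LinearMap.comp_sub, hΦ, hΨ, LinearMap.add_comp, add_sub_cancel_left]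
    · simp [hρ, hσ]
  | smul a φ _ h1 =>
    intro Φ ρ hΦ hρ
    obtain ⟨Ψ, σ, hΨ, hσ⟩ := lift φ
    rw [← add_sub_cancel (a • σ) ρ]
    refine add_mem (Submodule.smul_mem _ a (h1 hΨ hσ)) (Submodule.mem_sup_right
      (ker_map_mem_factorIdeal_of_comp_eq_zero (Φ := Φ - a • Ψ) ?_ fun x ↦ ?_))
    · rw [LinearMap.comp_sub, hΦ, LinearMap.comp_smul, hΨ, LinearMap.smul_comp, sub_self]
    · simp [hρ, hσ]

end Syzygy

/-- `B` is free over `S` on `1, u` where `u² = -f`, and `A = B/(u)`. -/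
structure DoubleCover (S B A : Type*) [CommRing S] [CommRing B] [CommRing A] [Algebra S B]
    [Algebra B A] where
  f : S
  u : B
  u_mul_u : u * u = -algebraMap S B f
  c₀ : B →ₗ[S] S
  c₁ : B →ₗ[S] S
  eq_add (b : B) : b = algebraMap S B (c₀ b) + algebraMap S B (c₁ b) * u
  c₁_one : c₁ 1 = 0
  c₁_u : c₁ u = 1
  surjective : Function.Surjective (algebraMap B A)
  ker_eq : RingHom.ker (algebraMap B A) = Ideal.span {u}

namespace DoubleCover

variable {S B A : Type*} [CommRing S] [CommRing B] [CommRing A] [Algebra S B]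
    [Algebra B A] (D : DoubleCover S B A)

theorem algebraMap_u : algebraMap B A D.u = 0 := by
  rw [← RingHom.mem_ker, D.ker_eq]
  exact Ideal.mem_span_singleton_self _

theorem u_smul {M : Type*} [AddCommGroup M] [Module B M] [Module A M] [IsScalarTower B A M]
    (m : M) : D.u • m = 0 := by
  rw [← algebraMap_smul A D.u m, D.algebraMap_u, zero_smul]

theorem c₁_u_mul (b : B) : D.c₁ (D.u * b) = D.c₀ b := by
  have h : D.u * b = D.c₀ b • D.u + (-(D.c₁ b * D.f)) • (1 : B) := by
    nth_rw 1 [D.eq_add b]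
    rw [Algebra.smul_def, Algebra.smul_def, map_neg, map_mul]
    linear_combination algebraMap S B (D.c₁ b) * D.u_mul_u
  rw [h, map_add, map_smul, map_smul, D.c₁_u, D.c₁_one]
  simp

theorem smul_eq {N : Type*} [AddCommGroup N] [Module B N] (b : B) (y : N) :
    b • y = algebraMap S B (D.c₀ b) • y + algebraMap S B (D.c₁ b) • D.u • y := by
  rw [smul_smul, ← add_smul, ← D.eq_add]

/-- An `S`-linear map that commutes with `u` is `B`-linear. -/
def linearMapOfComm {N N' : Type*} [AddCommGroup N] [Module S N] [Module B N]
    [IsScalarTower S B N] [AddCommGroup N'] [Module S N'] [Module B N'] [IsScalarTower S B N']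
    (φ : N →ₗ[S] N') (h : ∀ y, φ (D.u • y) = D.u • φ y) : N →ₗ[B] N' where
  toFun := φ
  map_add' := map_add φ
  map_smul' b y := by
    simp only [RingHom.id_apply]
    rw [D.smul_eq b y, D.smul_eq b (φ y), map_add, algebraMap_smul, algebraMap_smul, map_smul,
      map_smul, h, algebraMap_smul, algebraMap_smul]

/-- `N/uN` is the base change of `N` to `A = B/(u)`. -/
noncomputable def quotSMulTopEquiv (N : Type*) [AddCommGroup N] [Module B N] :
    QuotSMulTop D.u N ≃ₗ[B] A ⊗[B] N :=
  QuotSMulTop.equivQuotTensor D.u N ≪≫ₗ TensorProduct.congr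
    (Submodule.quotEquivOfEq _ (LinearMap.ker (Algebra.linearMap B A))
      (show Ideal.span {D.u} = RingHom.ker (algebraMap B A) from D.ker_eq.symm) ≪≫ₗ
      (Algebra.linearMap B A).quotKerEquivOfSurjective D.surjective) (LinearEquiv.refl B N)

theorem quotSMulTopEquiv_mk {N : Type*} [AddCommGroup N] [Module B N] (y : N) :
    D.quotSMulTopEquiv N (Submodule.Quotient.mk y) = 1 ⊗ₜ y := by
  simp only [quotSMulTopEquiv, QuotSMulTop.equivQuotTensor, LinearEquiv.trans_apply,
    Submodule.quotEquivOfEq_mk, TensorProduct.quotTensorEquivQuotSMul_symm_mk,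
    TensorProduct.congr_tmul, LinearEquiv.refl_apply]
  exact congrArg (· ⊗ₜ[B] y) (map_one (algebraMap B A))

theorem one_tmul_eq_zero_iff {N : Type*} [AddCommGroup N] [Module B N] (y : N) :
    (1 : A) ⊗ₜ[B] y = 0 ↔ ∃ z, y = D.u • z := by
  rw [← D.quotSMulTopEquiv_mk, LinearEquiv.map_eq_zero_iff, mk_quotSMulTop_eq_zero_iff]

section SyzygyOfQuotient

variable {M : Type*} [AddCommGroup M] [Module B M] [Module A M] [IsScalarTower B A M] {n : ℕ}
    (π : (Fin n → B) →ₗ[B] M)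

include D in
-- The inclusion sends `π g` to the class of `u g` in `ker π / u ker π`. The retraction is `π` of
-- the `u`-coordinate: that of `u g` is the constant coordinate of `g`, which has the same image as
-- `g` because `u` kills `M`.
theorem exists_retract_baseChange_ker (hπ : Function.Surjective π) :
    ∃ (i : M →ₗ[A] A ⊗[B] LinearMap.ker π) (p : A ⊗[B] LinearMap.ker π →ₗ[A] M),
      p ∘ₗ i = LinearMap.id := by
  let ℓ : S →ₗ[S] B := Algebra.linearMap S B
  let C₀ : (Fin n → B) →ₗ[S] (Fin n → B) := LinearMap.compLeft (ℓ ∘ₗ D.c₀) (Fin n)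
  let C₁ : (Fin n → B) →ₗ[S] (Fin n → B) := LinearMap.compLeft (ℓ ∘ₗ D.c₁) (Fin n)
  have hC (g : Fin n → B) : g = C₀ g + D.u • C₁ g := by
    ext j
    simp only [C₀, C₁, ℓ, Pi.add_apply, Pi.smul_apply, smul_eq_mul, LinearMap.compLeft_apply,
      Function.comp_apply, LinearMap.comp_apply, Algebra.linearMap_apply]
    rw [mul_comm D.u]
    exact D.eq_add (g j)
  have hC₁ (g : Fin n → B) : C₁ (D.u • g) = C₀ g := by
    ext j
    simp only [C₀, C₁, ℓ, Pi.smul_apply, smul_eq_mul, LinearMap.compLeft_apply,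
      Function.comp_apply, LinearMap.comp_apply, Algebra.linearMap_apply, D.c₁_u_mul]
  have hπC (g : Fin n → B) : π (C₀ g) = π g := by
    conv_rhs => rw [hC g, map_add, map_smul, D.u_smul, add_zero]
  let : Module S M := Module.compHom M (algebraMap S B)
  have : IsScalarTower S B M := .of_algebraMap_smul fun _ _ ↦ rfl
  -- It commutes with `u`: on `y` in `ker π` both sides are zero, since `π (C₁ (u y)) = π (C₀ y) = π
  -- y = 0`.
  let ρ : LinearMap.ker π →ₗ[B] M := D.linearMapOfComm
    (π.restrictScalars S ∘ₗ C₁ ∘ₗ (LinearMap.ker π).subtype.restrictScalars S) (fun y ↦ by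
      refine Eq.trans ?_ (D.u_smul (A := A) (π (C₁ y))).symm
      change π (C₁ (D.u • (y : Fin n → B))) = 0
      rw [hC₁, hπC, y.2])
  have hρ (y : LinearMap.ker π) : ρ y = π (C₁ y) := rfl
  have hu (g : Fin n → B) : D.u • g ∈ LinearMap.ker π := by
    rw [LinearMap.mem_ker, map_smul, D.u_smul]
  let σ : (Fin n → B) →ₗ[B] A ⊗[B] LinearMap.ker π :=
    TensorProduct.mk B A (LinearMap.ker π) 1 ∘ₗ
      (LinearMap.lsmul B (Fin n → B) D.u).codRestrict (LinearMap.ker π) hu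
  have hσ : LinearMap.ker π ≤ LinearMap.ker σ := by
    intro g hg
    exact (D.one_tmul_eq_zero_iff _).2 ⟨⟨g, hg⟩, Subtype.ext rfl⟩
  let i : M →ₗ[B] A ⊗[B] LinearMap.ker π :=
    (LinearMap.ker π).liftQ σ hσ ∘ₗ (π.quotKerEquivOfSurjective hπ).symm.toLinearMap
  have hi (g : Fin n → B) : i (π g) = 1 ⊗ₜ ⟨D.u • g, hu g⟩ := by
    have : (π.quotKerEquivOfSurjective hπ).symm (π g) = Submodule.Quotient.mk g := by
      rw [LinearEquiv.symm_apply_eq]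
      rfl
    simp only [i, LinearMap.comp_apply, LinearEquiv.coe_coe, this]
    rfl
  refine ⟨i.extendScalarsOfSurjective D.surjective, ρ.liftBaseChange A, ?_⟩
  ext m
  obtain ⟨g, rfl⟩ := hπ m
  simp only [LinearMap.comp_apply, LinearMap.extendScalarsOfSurjective_apply, hi,
    LinearMap.liftBaseChange_tmul, one_smul, LinearMap.id_apply, hρ, hC₁, hπC]

end SyzygyOfQuotient

section QuotientOfModule

variable (A) (N : Type*) [AddCommGroup N] [Module S N] [Module B N] [IsScalarTower S B N]

/-- The presentation of `N/uN` over `B` by `B ⊗ N`. -/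
noncomputable def quotPresentation : B ⊗[S] N →ₗ[B] A ⊗[B] N :=
  TensorProduct.mk B A N 1 ∘ₗ (LinearMap.id : N →ₗ[S] N).liftBaseChange B

theorem quotPresentation_surjective (hs : Function.Surjective (algebraMap B A)) :
    Function.Surjective (quotPresentation (S := S) (B := B) A N) := by
  refine (TensorProduct.mk_surjective B N A hs).comp fun y ↦ ⟨1 ⊗ₜ y, ?_⟩
  simp

variable {A N}

/-- The syzygy consists of the elements that multiplication `μ : B ⊗ N → N` sends into `uN`. The map
`J y = 1 ⊗ u y + u ⊗ y` is `B`-linear because `u²` comes from `S`, and `μ (J y) = 2 u y`, so the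
retraction is `μ` divided by `2u`. -/
theorem exists_retract_ker_quotPresentation (h2 : IsUnit (2 : B)) (hu : IsSMulRegular N D.u) :
    ∃ (i : N →ₗ[B] LinearMap.ker (quotPresentation (S := S) (B := B) A N))
      (p : LinearMap.ker (quotPresentation (S := S) (B := B) A N) →ₗ[B] N),
      p ∘ₗ i = LinearMap.id := by
  let μ : B ⊗[S] N →ₗ[B] N := (LinearMap.id : N →ₗ[S] N).liftBaseChange B
  let J : N →ₗ[B] B ⊗[S] N := D.linearMapOfComm
    (TensorProduct.mk S B N 1 ∘ₗ (LinearMap.lsmul B N D.u).restrictScalars S +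
      TensorProduct.mk S B N D.u) (fun y ↦ by
      have h1 : (1 : B) ⊗ₜ[S] (D.u • D.u • y) = (D.u * D.u) ⊗ₜ[S] y := by
        rw [smul_smul, D.u_mul_u, ← map_neg, algebraMap_smul, TensorProduct.tmul_smul,
          TensorProduct.smul_tmul', Algebra.smul_def, mul_one]
      simp only [LinearMap.add_apply, LinearMap.comp_apply, LinearMap.restrictScalars_apply,
        LinearMap.lsmul_apply, TensorProduct.mk_apply, smul_add, TensorProduct.smul_tmul',
        smul_eq_mul, mul_one]
      rw [h1, add_comm])
  have hJ (y : N) : J y = 1 ⊗ₜ (D.u • y) + D.u ⊗ₜ y := rfl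
  have hμJ (y : N) : μ (J y) = D.u • (2 : B) • y := by
    rw [hJ, map_add, two_smul, smul_add]
    simp [μ]
  have hmem (y : N) : J y ∈ LinearMap.ker (quotPresentation (S := S) (B := B) A N) :=
    (D.one_tmul_eq_zero_iff (μ (J y))).2 ⟨_, hμJ y⟩
  let e : N ≃ₗ[B] LinearMap.range (LinearMap.lsmul B N D.u) :=
    LinearEquiv.ofInjective (LinearMap.lsmul B N D.u) hu
  have hrange (x : LinearMap.ker (quotPresentation (S := S) (B := B) A N)) :
      μ x ∈ LinearMap.range (LinearMap.lsmul B N D.u) := by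
    obtain ⟨z, hz⟩ := (D.one_tmul_eq_zero_iff (μ x)).1 x.2
    exact ⟨z, hz.symm⟩
  refine ⟨J.codRestrict _ hmem, (↑h2.unit⁻¹ : B) • (e.symm.toLinearMap ∘ₗ
    (μ ∘ₗ Submodule.subtype _).codRestrict _ hrange), ?_⟩
  ext y
  have : e ((2 : B) • y) = ⟨μ (J y), hrange ⟨J y, hmem y⟩⟩ := Subtype.ext (hμJ y).symm
  have h3 : e.symm ⟨μ (J y), hrange ⟨J y, hmem y⟩⟩ = (2 : B) • y := by
    rw [← this, LinearEquiv.symm_apply_apply]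
  have h4 : (↑h2.unit⁻¹ : B) • e.symm ⟨μ (J y), hrange ⟨J y, hmem y⟩⟩ = y := by
    rw [h3, smul_smul, IsUnit.val_inv_mul, one_smul]
  exact h4

end QuotientOfModule

end DoubleCover

end DoubleCovers

/-! ### Transfer of lattices and of finite lattice type -/

section Transfer

open IsLocalRing TensorProduct RingTheory.Sequence

theorem DepthAtLeast.le_ringKrullDim {R : Type*} [CommRing R] [IsLocalRing R] [IsNoetherianRing R]
    {n : ℕ} (h : DepthAtLeast R n R) : n ≤ ringKrullDim R := by
  obtain ⟨p, hp⟩ := associatedPrimes.nonempty R R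
  exact (h.le_ringKrullDim_quotient p hp).trans (ringKrullDim_quotient_le p)

theorem ringKrullDim_le_length {R : Type*} [CommRing R] [IsLocalRing R] [IsNoetherianRing R]
    {rs : List R} (hrs : ∀ r ∈ rs, r ∈ maximalIdeal R)
    (h : ∀ q : Ideal R, q.IsPrime → (∀ r ∈ rs, r ∈ q) → q = maximalIdeal R) :
    ringKrullDim R ≤ rs.length := by
  rw [← ringKrullDim_eq_of_ringEquiv (RingEquiv.quotientBot R)]
  exact ringKrullDim_quotient_le_length bot_ne_top hrs fun q hq _ ↦ h q hq

namespace DoubleCover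

section

variable {S B A : Type*} [CommRing S] [CommRing B] [CommRing A] [Algebra S B]
    [Algebra B A] (D : DoubleCover S B A) [IsLocalRing S] [IsLocalRing B] [IsLocalRing A]

include D in
omit [IsLocalRing B] in
theorem isLocalHom_algebraMap : IsLocalHom (algebraMap S B) := by
  have hs : Function.Surjective ((algebraMap B A).comp (algebraMap S B)) := by
    intro a
    obtain ⟨b, rfl⟩ := D.surjective a
    refine ⟨D.c₀ b, ?_⟩
    conv_rhs => rw [D.eq_add b]
    simp [D.algebraMap_u]
  have : IsLocalHom ((algebraMap B A).comp (algebraMap S B)) := .of_surjective _ hs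
  exact isLocalHom_of_comp (algebraMap S B) (algebraMap B A)

omit [IsLocalRing S] in
theorem u_mem_maximalIdeal : D.u ∈ maximalIdeal B := by
  intro hu
  have := hu.map (algebraMap B A)
  rw [D.algebraMap_u] at this
  exact not_isUnit_zero this

omit [IsLocalRing S] [IsLocalRing B] [IsLocalRing A] in
theorem isSMulRegular_u [IsDomain S] (hf : D.f ≠ 0) {N : Type*} [AddCommGroup N] [Module S N]
    [Module B N] [IsScalarTower S B N] [Module.Free S N] : IsSMulRegular N D.u := by
  rw [isSMulRegular_iff_right_eq_zero_of_smul]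
  intro y hy
  have h : -(D.f • y) = 0 := by
    rw [← algebraMap_smul B D.f y, ← neg_smul, ← D.u_mul_u, mul_smul, hy, smul_zero]
  exact (smul_eq_zero.1 (neg_eq_zero.1 h)).resolve_left hf

include D in
theorem algebraMap_mem_maximalIdeal {x : S} (hx : x ∈ maximalIdeal S) :
    algebraMap S B x ∈ maximalIdeal B :=
  have := D.isLocalHom_algebraMap
  (map_mem_nonunits_iff (algebraMap S B) x).2 hx

include D in
theorem depthAtLeast_of_free {n : ℕ} (hS : DepthAtLeast S n S) {N : Type*} [AddCommGroup N]
    [Module S N] [Module B N] [IsScalarTower S B N] [Module.Free S N] : DepthAtLeast B n N := by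
  obtain ⟨rs, hm, hr, hl⟩ := hS
  refine ⟨rs.map (algebraMap S B), ?_, ?_, by simpa⟩
  · intro b hb
    obtain ⟨r, hr, rfl⟩ := List.mem_map.1 hb
    exact D.algebraMap_mem_maximalIdeal (hm r hr)
  · rw [isWeaklyRegular_map_algebraMap_iff]
    exact ((TensorProduct.rid S N).isWeaklyRegular_congr rs).1 (hr.isWeaklyRegular_lTensor (M₂ := N))

/-- As `B` is integral over `S`, a prime lying over the maximal ideal of `S` is maximal. -/
theorem eq_maximalIdeal_of_mem [Module.Finite S B] {xs : List S}
    (hxs : Ideal.ofList xs = maximalIdeal S) (q : Ideal B) (hq : q.IsPrime)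
    (h : ∀ r ∈ xs.map (algebraMap S B), r ∈ q) : q = maximalIdeal B := by
  have hle : maximalIdeal S ≤ q.comap (algebraMap S B) := by
    rw [← hxs, Ideal.ofList, Ideal.span_le]
    exact fun x hx ↦ h _ (List.mem_map_of_mem hx)
  have hmax : (q.comap (algebraMap S B)).IsMaximal := by
    rw [← (maximalIdeal.isMaximal S).eq_of_le Ideal.IsPrime.ne_top' hle]
    infer_instance
  have := Ideal.isMaximal_of_isIntegral_of_isMaximal_comap (R := S) q hmax
  exact eq_maximalIdeal this

variable [IsNoetherianRing S] [Module.Finite S B]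

include D in
-- The generators `xs` become a system generating an ideal primary to the maximal ideal of `B`, so
-- depth at least their number makes them regular on `N`.
theorem free_of_depthAtLeast {xs : List S} (hxs : Ideal.ofList xs = maximalIdeal S) {N : Type*}
    [AddCommGroup N] [Module S N] [Module B N] [IsScalarTower S B N] [Module.Finite B N]
    (h : DepthAtLeast B xs.length N) : Module.Free S N := by
  have : IsNoetherianRing B := .of_finite S B
  have : Module.Finite S N := .trans B N
  refine Module.free_of_isWeaklyRegular hxs ((isWeaklyRegular_map_algebraMap_iff B N xs).1 ?_)
  refine DepthAtLeast.isWeaklyRegular ⊥ ?_ ?_ ?_ (by simpa)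
  · intro a ha z
    rw [(Submodule.mem_bot B).1 ha, zero_smul]
  · intro b hb
    obtain ⟨r, hr, rfl⟩ := List.mem_map.1 hb
    exact D.algebraMap_mem_maximalIdeal (hxs ▸ Ideal.subset_span hr)
  · exact fun q hq _ ↦ eq_maximalIdeal_of_mem hxs q hq

variable {n : ℕ} {xs : List S} (hxs : Ideal.ofList xs = maximalIdeal S) (hn : xs.length = n + 1)
    (hS : DepthAtLeast S (n + 1) S) [Module.Free S B]

include D hxs hn hS

theorem ringKrullDim_total : ringKrullDim B = (n + 1 : ℕ) := by
  have : IsNoetherianRing B := .of_finite S B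
  refine le_antisymm ?_ (D.depthAtLeast_of_free hS).le_ringKrullDim
  refine (ringKrullDim_le_length (rs := xs.map (algebraMap S B)) ?_
    (eq_maximalIdeal_of_mem hxs)).trans (by simp [hn])
  intro b hb
  obtain ⟨r, hr, rfl⟩ := List.mem_map.1 hb
  exact D.algebraMap_mem_maximalIdeal (hxs ▸ Ideal.subset_span hr)

theorem ringKrullDim_base [IsDomain S] (hf : D.f ≠ 0) : ringKrullDim A = n := by
  have : IsNoetherianRing B := .of_finite S B
  have h := ringKrullDim_quotient_span_singleton_succ_eq_ringKrullDim
    (D.isSMulRegular_u (N := B) hf) D.u_mem_maximalIdeal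
  rw [D.ringKrullDim_total hxs hn hS, ← D.ker_eq, ringKrullDim_eq_of_ringEquiv
    (RingHom.quotientKerEquivOfSurjective D.surjective)] at h
  exact ENat.WithBot.add_one_cancel.1 (by exact_mod_cast h)

end

section

variable {S B A : Type u} [CommRing S] [CommRing B] [CommRing A] [Algebra S B]
    [Algebra B A] (D : DoubleCover S B A) [IsLocalRing S] [IsLocalRing B] [IsLocalRing A]
    [IsNoetherianRing S] [IsDomain S] [Module.Finite S B] [Module.Free S B]
    {n : ℕ} {xs : List S} (hxs : Ideal.ofList xs = maximalIdeal S) (hn : xs.length = n + 1)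
    (hS : DepthAtLeast S (n + 1) S) (hf : D.f ≠ 0)

include D hxs hn hS hf

/-- `N` is free over `S`, so `u` is regular on it; depth and dimension both drop by one. -/
theorem isLattice_baseChange {N : Type u} [AddCommGroup N] [Module B N] (h : IsLattice B N) :
    IsLattice A (A ⊗[B] N) := by
  have : IsNoetherianRing B := .of_finite S B
  have : IsNoetherianRing A := isNoetherianRing_of_surjective B A (algebraMap B A) D.surjective
  obtain ⟨hcm, hfree⟩ := h
  rw [isMaximalCohenMacaulay_iff (D.ringKrullDim_total hxs hn hS)] at hcm
  obtain ⟨hfin, hd⟩ := hcm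
  let : Module S N := Module.compHom N (algebraMap S B)
  have : IsScalarTower S B N := .of_algebraMap_smul fun _ _ ↦ rfl
  have : Module.Free S N := D.free_of_depthAtLeast hxs (hn ▸ hd)
  refine ⟨(isMaximalCohenMacaulay_iff (D.ringKrullDim_base hxs hn hS hf)).2 ⟨inferInstance, ?_⟩, ?_⟩
  · rw [← depthAtLeast_iff_of_surjective D.surjective]
    exact (hd.quotSMulTop D.u_mem_maximalIdeal (D.isSMulRegular_u hf)).of_linearEquiv
      (D.quotSMulTopEquiv N)
  · rw [isFreeOnPuncturedSpectrum_iff] at hfree ⊢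
    intro a ha
    obtain ⟨b, rfl⟩ := D.surjective a
    have hlocal : IsLocalHom (algebraMap B A) := .of_surjective _ D.surjective
    obtain ⟨k, hk⟩ := hfree b ((map_mem_nonunits_iff (algebraMap B A) b).1 ha)
    refine ⟨k, ?_⟩
    rw [← map_pow]
    exact baseChange_smul_id_mem_factorIdeal A hk

/-- The depth lemma gives one more than the depth of `M`. On the punctured spectrum, `bᵏ` on `M`
factors through copies of `A`, so on the syzygy it factors through free modules and syzygies of `A`,
and the syzygy `uB` of `A` is free. -/
theorem isLattice_ker {M : Type u} [AddCommGroup M] [Module A M] [Module B M] [IsScalarTower B A M]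
    (h : IsLattice A M) {m : ℕ} {π : (Fin m → B) →ₗ[B] M} (hπ : Function.Surjective π) :
    IsLattice B (LinearMap.ker π) := by
  have : IsNoetherianRing B := .of_finite S B
  have : IsNoetherianRing A := isNoetherianRing_of_surjective B A (algebraMap B A) D.surjective
  obtain ⟨hcm, hfree⟩ := h
  rw [isMaximalCohenMacaulay_iff (D.ringKrullDim_base hxs hn hS hf)] at hcm
  obtain ⟨hfin, hd⟩ := hcm
  have : Module.Finite B M := .of_surjective π hπ
  refine ⟨(isMaximalCohenMacaulay_iff (D.ringKrullDim_total hxs hn hS)).2 ⟨inferInstance, ?_⟩, ?_⟩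
  · rw [← depthAtLeast_iff_of_surjective D.surjective] at hd
    exact DepthAtLeast.of_exact Subtype.val_injective π.exact_subtype_ker_map hπ
      (D.depthAtLeast_of_free hS) hd
  · rw [isFreeOnPuncturedSpectrum_iff] at hfree ⊢
    intro b hb
    have hlocal : IsLocalHom (algebraMap B A) := .of_surjective _ D.surjective
    obtain ⟨k, hk⟩ := hfree _ ((map_mem_nonunits_iff (algebraMap B A) b).2 hb)
    refine ⟨k, ?_⟩
    have h1 : b ^ k • LinearMap.id ∈ factorIdeal B (fun _ : Unit ↦ A) M M := by
      convert restrictScalars_mem_factorIdeal B D.surjective hk using 1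
      ext x
      simp [← map_pow]
    have h2 := ker_map_mem_factorIdeal (q := fun _ : Unit ↦ Algebra.linearMap B A)
      (fun _ ↦ D.surjective) hπ h1 (π := π) (Φ := b ^ k • LinearMap.id)
      (ρ := b ^ k • LinearMap.id) (by ext; simp) (fun x ↦ rfl)
    obtain ⟨φ, hφ, ψ, hψ, hsum⟩ := Submodule.mem_sup.1 h2
    rw [← hsum]
    refine add_mem (factorIdeal_trans hφ fun _ ↦ ?_) hψ
    have e : B ≃ₗ[B] LinearMap.ker (Algebra.linearMap B A) :=
      LinearEquiv.ofInjective (LinearMap.lsmul B B D.u) (D.isSMulRegular_u hf) ≪≫ₗ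
        LinearEquiv.ofEq _ _ (by
          ext b
          change _ ↔ b ∈ RingHom.ker (algebraMap B A)
          rw [D.ker_eq, Ideal.mem_span_singleton']
          simp [mul_comm])
    have : Module.Finite B (LinearMap.ker (Algebra.linearMap B A)) := .equiv e
    have : Module.Projective B (LinearMap.ker (Algebra.linearMap B A)) := .of_equiv e
    exact id_mem_factorIdeal_self _

/-- Finite lattice type passes between `A` and its double cover `B`. -/
theorem isOfFiniteLatticeType_iff [IsAdicComplete (maximalIdeal S) S] (h2 : IsUnit (2 : S)) :
    IsOfFiniteLatticeType A ↔ IsOfFiniteLatticeType B := by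
  have : IsNoetherianRing B := .of_finite S B
  have : IsNoetherianRing A := isNoetherianRing_of_surjective B A (algebraMap B A) D.surjective
  constructor
  · intro h
    obtain ⟨ι, _, L, hL, hLid⟩ := h.exists_family
    have (i : ι) : Module.Finite A (L i) := (hL i).maximalCohenMacaulay.finite
    let (i : ι) : Module B (L i) := Module.compHom (L i) (algebraMap B A)
    have (i : ι) : IsScalarTower B A (L i) := .of_algebraMap_smul fun _ _ ↦ rfl
    have : Module.Finite B A := .of_surjective (Algebra.linearMap B A) D.surjective
    have (i : ι) : Module.Finite B (L i) := .trans A (L i)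
    choose r q hq using fun i ↦ Module.Finite.exists_fin' B (L i)
    -- The syzygies of the `L i`, together with `B` itself to absorb the maps through free modules.
    let X : Option ι → ModuleCat.{u} B := fun o ↦
      o.elim (ModuleCat.of B B) fun i ↦ ModuleCat.of B (LinearMap.ker (q i))
    have hX : ∀ o, Module.Finite B (X o)
      | none => inferInstanceAs (Module.Finite B B)
      | some i => inferInstanceAs (Module.Finite B (LinearMap.ker (q i)))
    refine IsOfFiniteLatticeType.of_family (S := S) X fun N _ _ hN ↦ ?_
    have hcm := (isMaximalCohenMacaulay_iff (D.ringKrullDim_total hxs hn hS)).1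
      hN.maximalCohenMacaulay
    have := hcm.1
    let : Module S N := Module.compHom N (algebraMap S B)
    have : IsScalarTower S B N := .of_algebraMap_smul fun _ _ ↦ rfl
    have : Module.Free S N := D.free_of_depthAtLeast hxs (hn ▸ hcm.2)
    have : Module.Finite S N := .trans B N
    have hlat := D.isLattice_baseChange hxs hn hS hf hN
    have h1 := restrictScalars_mem_factorIdeal B D.surjective (hLid _ hlat)
    -- The identity of the syzygy is induced by the identity of `N/uN`.
    have h3 := ker_map_mem_factorIdeal hq (quotPresentation_surjective (S := S) A N D.surjective)
      h1 (π := quotPresentation (S := S) A N) (Φ := LinearMap.id) (ρ := LinearMap.id) rfl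
      (fun x ↦ rfl)
    obtain ⟨i, p, hpi⟩ := D.exists_retract_ker_quotPresentation (N := N)
      (map_ofNat (algebraMap S B) 2 ▸ h2.map (algebraMap S B)) (D.isSMulRegular_u hf)
    have hid : LinearMap.id ∈ factorIdeal B (fun o ↦ X o)
        (LinearMap.ker (quotPresentation (S := S) (B := B) A N))
        (LinearMap.ker (quotPresentation (S := S) (B := B) A N)) := by
      obtain ⟨φ, hφ, ψ, hψ, hsum⟩ := Submodule.mem_sup.1 h3
      rw [← hsum]
      refine add_mem ?_ ?_
      · exact factorIdeal_mono (Y := fun o ↦ X o) some (fun i ↦ LinearEquiv.refl B _) hφ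
      · exact factorIdeal_mono (Y := fun o ↦ X o) (fun _ ↦ none) (fun i ↦ LinearEquiv.refl B _) hψ
    exact id_mem_factorIdeal_of_retract i p hpi hid
  · intro h
    obtain ⟨ι, _, L, hL, hLid⟩ := h.exists_family
    have (i : ι) : Module.Finite B (L i) := (hL i).maximalCohenMacaulay.finite
    let : Algebra S A := ((algebraMap B A).comp (algebraMap S B)).toAlgebra
    have : IsScalarTower S B A := .of_algebraMap_eq fun _ ↦ rfl
    have : Module.Finite B A := .of_surjective (Algebra.linearMap B A) D.surjective
    have : Module.Finite S A := .trans B A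
    let X : ι → ModuleCat.{u} A := fun i ↦ ModuleCat.of A (A ⊗[B] L i)
    have (i : ι) : Module.Finite A (X i) := inferInstanceAs (Module.Finite A (A ⊗[B] L i))
    refine IsOfFiniteLatticeType.of_family (S := S) X fun M _ _ hM ↦ ?_
    have := hM.maximalCohenMacaulay.finite
    let : Module B M := Module.compHom M (algebraMap B A)
    have : IsScalarTower B A M := .of_algebraMap_smul fun _ _ ↦ rfl
    have : Module.Finite B M := .trans A M
    obtain ⟨r, π, hπ⟩ := Module.Finite.exists_fin' B M
    have hlat := D.isLattice_ker hxs hn hS hf hM hπ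
    have h1 := baseChange_mem_factorIdeal A (hLid _ hlat)
    rw [LinearMap.baseChange_id] at h1
    obtain ⟨i, p, hpi⟩ := D.exists_retract_baseChange_ker π hπ
    exact id_mem_factorIdeal_of_retract i p hpi h1

end

end DoubleCover

end Transfer

/-! ### Power series rings and the double branched cover -/

section PowerSeriesRings

open IsLocalRing

theorem DepthAtLeast.succ_of_surjective {R R' : Type*} [CommRing R] [CommRing R'] [IsLocalRing R]
    [IsLocalRing R'] [Algebra R R'] {n : ℕ} (h : DepthAtLeast R' n R')
    (hs : Function.Surjective (algebraMap R R')) {x : R} (hx : x ∈ maximalIdeal R)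
    (hr : IsSMulRegular R x) (hker : RingHom.ker (algebraMap R R') = Ideal.span {x}) :
    DepthAtLeast R (n + 1) R := by
  rw [← depthAtLeast_iff_of_surjective hs] at h
  refine depthAtLeast_succ_iff.2 ⟨x, hx, hr, h.of_linearEquiv (LinearEquiv.symm ?_)⟩
  refine Submodule.quotEquivOfEq _ (LinearMap.ker (Algebra.linearMap R R')) ?_ ≪≫ₗ
    (Algebra.linearMap R R').quotKerEquivOfSurjective hs
  rw [show LinearMap.ker (Algebra.linearMap R R') = Ideal.span {x} from hker,
    ← Submodule.ideal_span_singleton_smul, smul_eq_mul, Ideal.mul_top]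

namespace MvPowerSeries

variable {k : Type*} [Field k]

/-- Induction on the number of variables: `f` is its value at `X 0 = 0` plus a multiple of `X 0`. -/
theorem mem_span_range_X_of_constantCoeff_eq_zero {n : ℕ} {f : MvPowerSeries (Fin n) k}
    (hf : constantCoeff f = 0) : f ∈ Ideal.span (Set.range X) := by
  induction n with
  | zero =>
    have : f = 0 := (isEmptyEquiv (Fin 0) k).injective (by simpa using hf)
    rw [this]
    exact zero_mem _
  | succ n ih =>
    let e := finSuccEquiv k n
    have hc : constantCoeff (PowerSeries.constantCoeff (e f)) = 0 := by
      rw [← PowerSeries.coeff_zero_eq_constantCoeff_apply, ← coeff_zero_eq_constantCoeff_apply,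
        coeff_coeff_finSuccEquiv]
      simpa using hf
    have hmem := Ideal.mem_map_of_mem (e.symm.toRingEquiv.toRingHom.comp PowerSeries.C) (ih hc)
    obtain ⟨g, hg⟩ := PowerSeries.X_dvd_iff.2
      (show PowerSeries.constantCoeff (e f - PowerSeries.C (PowerSeries.constantCoeff (e f))) = 0 by
        simp)
    have hfeq : f = e.symm (PowerSeries.C (PowerSeries.constantCoeff (e f))) + X 0 * e.symm g := by
      apply e.injective
      rw [map_add, map_mul, e.apply_symm_apply, e.apply_symm_apply, finSuccEquiv_X_zero, ← hg]
      ring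
    rw [hfeq]
    refine add_mem ?_ (Ideal.mul_mem_right _ _ (Ideal.subset_span ⟨0, rfl⟩))
    refine (Ideal.map_le_iff_le_comap.2 ?_) hmem
    rw [Ideal.span_le]
    rintro _ ⟨j, rfl⟩
    refine Ideal.subset_span ⟨j.succ, ?_⟩
    apply e.injective
    simp [e]

theorem span_range_X_eq_maximalIdeal (n : ℕ) :
    Ideal.span (Set.range X) = maximalIdeal (MvPowerSeries (Fin n) k) := by
  refine le_antisymm (le_maximalIdeal ?_) fun f hf ↦ mem_span_range_X_of_constantCoeff_eq_zero ?_
  · rw [Ne, Ideal.eq_top_iff_one]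
    intro h1
    have hle : Ideal.span (Set.range X) ≤
        RingHom.ker (constantCoeff (σ := Fin n) (R := k)) := by
      rw [Ideal.span_le]
      rintro _ ⟨i, rfl⟩
      simp [RingHom.mem_ker]
    simpa [RingHom.mem_ker] using hle h1
  · rw [mem_maximalIdeal, mem_nonunits_iff, isUnit_iff_constantCoeff] at hf
    simpa using hf

theorem ofList_X_eq_maximalIdeal (n : ℕ) :
    Ideal.ofList (List.ofFn (X : Fin n → MvPowerSeries (Fin n) k)) = maximalIdeal _ := by
  have h : {r | r ∈ List.ofFn (X : Fin n → MvPowerSeries (Fin n) k)} = Set.range X := by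
    ext r
    simp [List.mem_ofFn]
  rw [Ideal.ofList, h, span_range_X_eq_maximalIdeal]

theorem depthAtLeast (n : ℕ) :
    DepthAtLeast (MvPowerSeries (Fin n) k) n (MvPowerSeries (Fin n) k) := by
  induction n with
  | zero => exact depthAtLeast_zero _
  | succ n ih =>
    let e := finSuccEquiv k n
    let φ : MvPowerSeries (Fin (n + 1)) k →+* MvPowerSeries (Fin n) k :=
      PowerSeries.constantCoeff.comp (e : _ →+* _)
    have hφ : Function.Surjective φ :=
      PowerSeries.constantCoeff_surj.comp e.surjective
    let : Algebra (MvPowerSeries (Fin (n + 1)) k) (MvPowerSeries (Fin n) k) := φ.toAlgebra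
    have hX : (X 0 : MvPowerSeries (Fin (n + 1)) k) ∈ maximalIdeal _ := by
      rw [mem_maximalIdeal, mem_nonunits_iff, isUnit_iff_constantCoeff]
      simp
    have hX0 : (X 0 : MvPowerSeries (Fin (n + 1)) k) ≠ 0 := fun h ↦ by
      have := congrArg (coeff (Finsupp.single 0 1)) h
      rw [coeff_index_single_self_X] at this
      simp at this
    refine ih.succ_of_surjective hφ hX (IsRegular.of_ne_zero hX0).left ?_
    ext f
    rw [RingHom.mem_ker, Ideal.mem_span_singleton]
    change PowerSeries.constantCoeff (e f) = 0 ↔ _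
    rw [← PowerSeries.X_dvd_iff, ← finSuccEquiv_X_zero]
    exact map_dvd_iff e

end MvPowerSeries

section

open Polynomial

variable {k : Type u} [Field k] {d : ℕ} {f : MvPowerSeries (Fin (d + 1)) k}

instance MvPowerSeries.isAdicComplete_maximalIdeal (n : ℕ) :
    IsAdicComplete (maximalIdeal (MvPowerSeries (Fin n) k)) (MvPowerSeries (Fin n) k) := by
  rw [← span_range_X_eq_maximalIdeal]
  infer_instance

theorem monic_X_sq_add_C {S : Type*} [CommRing S] [Nontrivial S] (a : S) :
    (X ^ 2 + C a).Monic :=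
  monic_X_pow_add_C a two_ne_zero

/-- This lets Weierstrass division replace `S[[X]]/(X² + f)` by `S[X]/(X² + f)`, whose `S`-basis is
`1, X`. -/
theorem isDistinguishedAt_X_sq_add_C {S : Type*} [CommRing S] [Nontrivial S] {I : Ideal S} {a : S}
    (ha : a ∈ I) : (X ^ 2 + C a).IsDistinguishedAt I where
  mem {i} hi := by
    rw [natDegree_X_pow_add_C] at hi
    interval_cases i <;> simp [coeff_X_pow, coeff_C, ha]
  monic := monic_X_sq_add_C a

/-- `S[X]/(X² + f)` is the double branched cover. -/
noncomputable def adjoinRootEquivDoubleBranchedCover (hf : f ∈ variableIdeal k d ^ 2) :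
    AdjoinRoot (X ^ 2 + C f) ≃ₐ[MvPowerSeries (Fin (d + 1)) k] DoubleBranchedCover f :=
  (isDistinguishedAt_X_sq_add_C (I := maximalIdeal _) (a := f)
    (by
      rw [mem_maximalIdeal, mem_nonunits_iff, MvPowerSeries.isUnit_iff_constantCoeff,
        constantCoeff_eq_zero_of_mem hf]
      exact not_isUnit_zero)).algEquivQuotient.trans
    (Ideal.quotientEquivAlgOfEq _ (by
      congr 2
      simp [add_comm]))

theorem adjoinRootEquivDoubleBranchedCover_root (hf : f ∈ variableIdeal k d ^ 2) :
    adjoinRootEquivDoubleBranchedCover hf (AdjoinRoot.root _) =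
      Ideal.Quotient.mk _ PowerSeries.X := by
  change Ideal.Quotient.mk _ ((X : (MvPowerSeries (Fin (d + 1)) k)[X]).toPowerSeries) = _
  rw [Polynomial.coe_X]

theorem DoubleBranchedCover.free (hf : f ∈ variableIdeal k d ^ 2) :
    Module.Free (MvPowerSeries (Fin (d + 1)) k) (DoubleBranchedCover f) :=
  .of_basis ((AdjoinRoot.powerBasis' (monic_X_sq_add_C f)).basis.map
    (adjoinRootEquivDoubleBranchedCover hf).toLinearEquiv)

theorem DoubleBranchedCover.finite (hf : f ∈ variableIdeal k d ^ 2) :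
    Module.Finite (MvPowerSeries (Fin (d + 1)) k) (DoubleBranchedCover f) :=
  .of_basis ((AdjoinRoot.powerBasis' (monic_X_sq_add_C f)).basis.map
    (adjoinRootEquivDoubleBranchedCover hf).toLinearEquiv)

/-- The coordinates of the elements of `R♯ = S ⊕ S u`. -/
noncomputable def DoubleBranchedCover.coord (hf : f ∈ variableIdeal k d ^ 2) (i : ℕ) :
    DoubleBranchedCover f →ₗ[MvPowerSeries (Fin (d + 1)) k] MvPowerSeries (Fin (d + 1)) k :=
  Polynomial.lcoeff _ i ∘ₗ AdjoinRoot.modByMonicHom (monic_X_sq_add_C f) ∘ₗ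
    (adjoinRootEquivDoubleBranchedCover hf).symm.toLinearMap

theorem DoubleBranchedCover.coord_apply (hf : f ∈ variableIdeal k d ^ 2) (i : ℕ)
    {p : (MvPowerSeries (Fin (d + 1)) k)[X]} (hp : p.degree < 2) :
    coord hf i (adjoinRootEquivDoubleBranchedCover hf (AdjoinRoot.mk _ p)) = p.coeff i := by
  have hmod : p %ₘ (X ^ 2 + C f) = p :=
    (modByMonic_eq_self_iff (monic_X_sq_add_C f)).2 (by
      rwa [degree_X_pow_add_C two_pos])
  simp [coord, AdjoinRoot.modByMonicHom_mk, hmod]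

/-- The map `R♯ → R` that sends `u` to `0`. -/
noncomputable def DoubleBranchedCover.toHypersurface (f : MvPowerSeries (Fin (d + 1)) k) :
    DoubleBranchedCover f →+* Hypersurface f :=
  Ideal.Quotient.lift _ ((Ideal.Quotient.mk _).comp PowerSeries.constantCoeff) fun g hg ↦ by
    obtain ⟨h, rfl⟩ := Ideal.mem_span_singleton.1 hg
    simp

theorem DoubleBranchedCover.toHypersurface_surjective (f : MvPowerSeries (Fin (d + 1)) k) :
    Function.Surjective (toHypersurface f) :=
  Ideal.Quotient.lift_surjective_of_surjective _ _
    (Ideal.Quotient.mk_surjective.comp PowerSeries.constantCoeff_surj)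

theorem DoubleBranchedCover.mk_X_mul_mk_X (f : MvPowerSeries (Fin (d + 1)) k) :
    (Ideal.Quotient.mk _ PowerSeries.X * Ideal.Quotient.mk _ PowerSeries.X :
      DoubleBranchedCover f) = -algebraMap (MvPowerSeries (Fin (d + 1)) k) _ f := by
  rw [eq_neg_iff_add_eq_zero, IsScalarTower.algebraMap_apply _
    (PowerSeries (MvPowerSeries (Fin (d + 1)) k)) (DoubleBranchedCover f), ← map_mul, Ideal.Quotient.algebraMap_eq, ← map_add,
    Ideal.Quotient.eq_zero_iff_mem, Ideal.mem_span_singleton]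
  exact dvd_of_eq (by rw [PowerSeries.algebraMap_apply, Algebra.algebraMap_self_apply]; ring)

theorem DoubleBranchedCover.ker_toHypersurface (f : MvPowerSeries (Fin (d + 1)) k) :
    RingHom.ker (toHypersurface f) = Ideal.span {Ideal.Quotient.mk _ PowerSeries.X} := by
  refine le_antisymm (fun b hb ↦ ?_) ?_
  · obtain ⟨g, rfl⟩ := Ideal.Quotient.mk_surjective b
    have hg : Ideal.Quotient.mk (Ideal.span {f}) (PowerSeries.constantCoeff g) = 0 := hb
    rw [Ideal.Quotient.eq_zero_iff_mem, Ideal.mem_span_singleton] at hg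
    obtain ⟨h, hh⟩ := hg
    obtain ⟨g', hg'⟩ := PowerSeries.X_dvd_iff.2
      (show PowerSeries.constantCoeff (g - PowerSeries.C (PowerSeries.constantCoeff g)) = 0 by simp)
    -- The constant term of `g` is `f h`, and `f` equals `-X²` in the quotient, so all of `g`
    -- becomes a multiple of `X`.
    have hgen : Ideal.Quotient.mk (Ideal.span {PowerSeries.C f + PowerSeries.X ^ 2}) g =
        Ideal.Quotient.mk _ (PowerSeries.X * (g' - PowerSeries.X * PowerSeries.C h)) := by
      rw [Ideal.Quotient.eq, Ideal.mem_span_singleton]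
      refine ⟨PowerSeries.C h, ?_⟩
      rw [hh, map_mul] at hg'
      linear_combination hg'
    rw [hgen, map_mul]
    exact Ideal.mul_mem_right _ _ (Ideal.mem_span_singleton_self _)
  · rw [Ideal.span_singleton_le_iff_mem, RingHom.mem_ker]
    simp [toHypersurface]

noncomputable instance DoubleBranchedCover.algebraHypersurface
    (f : MvPowerSeries (Fin (d + 1)) k) :
    Algebra (DoubleBranchedCover f) (Hypersurface f) :=
  (toHypersurface f).toAlgebra

/-- The double branched cover of a hypersurface is a double cover. -/
noncomputable def DoubleBranchedCover.doubleCover (hf : f ∈ variableIdeal k d ^ 2) :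
    DoubleCover (MvPowerSeries (Fin (d + 1)) k) (DoubleBranchedCover f) (Hypersurface f) where
  f := f
  u := Ideal.Quotient.mk _ PowerSeries.X
  u_mul_u := mk_X_mul_mk_X f
  c₀ := coord hf 0
  c₁ := coord hf 1
  eq_add b := by
    obtain ⟨y, rfl⟩ := (adjoinRootEquivDoubleBranchedCover hf).surjective b
    obtain ⟨p, hp, rfl⟩ : ∃ p : (MvPowerSeries (Fin (d + 1)) k)[X],
        p.degree < 2 ∧ AdjoinRoot.mk _ p = y := by
      refine ⟨AdjoinRoot.modByMonicHom (monic_X_sq_add_C f) y, ?_,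
        AdjoinRoot.mk_leftInverse (monic_X_sq_add_C f) y⟩
      obtain ⟨q, rfl⟩ := AdjoinRoot.mk_surjective y
      rw [AdjoinRoot.modByMonicHom_mk, ← Nat.cast_two (R := WithBot ℕ),
        ← degree_X_pow_add_C two_pos f]
      exact degree_modByMonic_lt _ (monic_X_sq_add_C f)
    rw [coord_apply hf 0 hp, coord_apply hf 1 hp, ← adjoinRootEquivDoubleBranchedCover_root hf,
      ← (adjoinRootEquivDoubleBranchedCover hf).commutes,
      ← (adjoinRootEquivDoubleBranchedCover hf).commutes, ← map_mul, ← map_add,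
      AdjoinRoot.algebraMap_eq, ← AdjoinRoot.mk_C, ← AdjoinRoot.mk_C, ← AdjoinRoot.mk_X,
      ← map_mul, ← map_add]
    congr 2
    rw [add_comm (C _)]
    exact eq_X_add_C_of_degree_le_one (Order.lt_succ_iff.1 hp)
  c₁_one := by
    simpa [coeff_one] using coord_apply hf 1 (p := 1) (degree_one_le.trans_lt (by norm_num))
  c₁_u := by
    rw [← adjoinRootEquivDoubleBranchedCover_root hf, ← AdjoinRoot.mk_X,
      coord_apply hf 1 (degree_X_le.trans_lt (by norm_num)), coeff_X_one]
  surjective := toHypersurface_surjective f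
  ker_eq := ker_toHypersurface f

end

end PowerSeriesRings

theorem mainTheorem8 {k : Type u} [Field k] [CharZero k] (d : ℕ)
    (f : MvPowerSeries (Fin (d + 1)) k) (hf₀ : f ≠ 0) (hf : f ∈ variableIdeal k d ^ 2) :
    haveI : IsLocalRing (Hypersurface f) := Hypersurface.isLocalRing hf
    haveI : IsLocalRing (DoubleBranchedCover f) := DoubleBranchedCover.isLocalRing hf
    IsOfFiniteLatticeType (Hypersurface f) ↔ IsOfFiniteLatticeType (DoubleBranchedCover f) := by
  have : IsLocalRing (Hypersurface f) := Hypersurface.isLocalRing hf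
  have : IsLocalRing (DoubleBranchedCover f) := DoubleBranchedCover.isLocalRing hf
  have := NoZeroDivisors.to_isDomain (MvPowerSeries (Fin (d + 1)) k)
  have := DoubleBranchedCover.free hf
  have := DoubleBranchedCover.finite hf
  refine (DoubleBranchedCover.doubleCover hf).isOfFiniteLatticeType_iff
    (MvPowerSeries.ofList_X_eq_maximalIdeal (d + 1)) List.length_ofFn
    (MvPowerSeries.depthAtLeast (d + 1)) hf₀ ?_
  -- Characteristic zero enters only here, to make 2 a unit of `S`.
  rw [MvPowerSeries.isUnit_iff_constantCoeff, map_ofNat]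
  exact IsUnit.mk0 _ two_ne_zero
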